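/- For integers $m,n$ let $C_{m,n}\subseteq S_{mn}$ be the stabilizer of a partition of the set $\{1,\dots,mn\}$ into $n$ blocks of size $m$ (the wreath product of $S_m$, acting inside the blocks, by $S_n$, permuting the blocks), and let $V_n=\mathrm{Ind}_{C_{3,n}}^{S_{3n}}(1)$ be the complex representation of $S_{3n}$ induced from the trivial representation of $C_{3,n}$. For a finite weakly decreasing sequence $\lambda=(\lambda_1,\dots,\lambda_k)$ of positive integers, the partition of $3n$ with pattern $(*,\lambda)$ is the partition $(3n-\lambda_1-\cdots-\lambda_k,\lambda_1,\dots,\lambda_k)$ of $3n$ into exactly $k+1$ positive parts, when this is a partition. Then: 1. for every $n\ge 5$ and every $$\lambda\in\{\emptyset,\,(2),\,(3),\,(4),\,(2,2),\,(5),\,(4,1),\,(3,2)\},$$ the partition of $3n$ with pattern $(*,\lambda)$ exists and the corresponding Specht module has multiplicity exactly $1$ in $V_n$; 2. for every $n\ge 0$ and every $$\lambda\in\{(1),\,(2,1),\,(3,1),\,(2,2,1),\,(3,1,1),\,(4,1,1)\},$$ if the partition of $3n$ with pattern $(*,\lambda)$ exists, then the corresponding Specht module does not occur in $V_n$. -/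

import Mathlib

open scoped MonoidAlgebra

namespace BV

noncomputable section

/-! ## Induced representation -/

/-- The subgroup `C_{m,n}` of `S_{mn}`: the stabilizer of the set partition of the `mn` points into
the `n` consecutive blocks `{mb, mb + 1, …, mb + m - 1}` of size `m`. As an abstract group it is
the wreath product of `S_m` (acting inside each block) by `S_n` (permuting the blocks). -/
def blockStabilizer (m n : ℕ) : Subgroup (Equiv.Perm (Fin (m * n))) where
  carrier := {σ | ∀ x y : Fin (m * n),
    (σ x : ℕ) / m = (σ y : ℕ) / m ↔ (x : ℕ) / m = (y : ℕ) / m}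
  one_mem' := fun _ _ => Iff.rfl
  mul_mem' := fun {σ τ} hσ hτ x y => (hσ (τ x) (τ y)).trans (hτ x y)
  inv_mem' := fun {σ} hσ x y => by
    have h := hσ (σ⁻¹ x) (σ⁻¹ y)
    simpa using h.symm

/-- The complex representation `Ind_{C_{m,n}}^{S_{mn}}(1)` of `S_{mn}`. -/
abbrev inducedTrivial (m n : ℕ) :=
  Representation.ind (blockStabilizer m n).subtype
    (Representation.trivial ℂ (blockStabilizer m n) ℂ)

/-! ## Specht modules -/

/-- A tabloid of shape `μ` on `N` letters, recorded by the function that sends a letter to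
(the index of) its row: the `i`-th row contains exactly `μ.rowLen i` letters. -/
def Tabloid (μ : YoungDiagram) (N : ℕ) : Type :=
  {r : Fin N → ℕ // ∀ i : ℕ, (Finset.univ.filter fun x => r x = i).card = μ.rowLen i}

/-- The action of `S_N` on tabloids by permuting the letters. -/
instance (μ : YoungDiagram) (N : ℕ) : MulAction (Equiv.Perm (Fin N)) (Tabloid μ N) where
  smul σ r := ⟨fun x => r.1 (σ⁻¹ x), fun i => by
    rw [← r.2 i]
    exact Finset.card_equiv σ⁻¹ (by intro x; simp)⟩
  one_smul _ := rfl
  mul_smul σ τ r := Subtype.ext (funext fun x => by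
    change r.1 ((σ * τ)⁻¹ x) = r.1 (τ⁻¹ (σ⁻¹ x))
    simp [mul_inv_rev])

/-- The permutation module `M^μ` on the tabloids of shape `μ`. -/
def tabloidRep (μ : YoungDiagram) (N : ℕ) :
    Representation ℂ (Equiv.Perm (Fin N)) (Tabloid μ N →₀ ℂ) where
  toFun σ := Finsupp.lmapDomain ℂ ℂ (fun r => σ • r)
  map_one' := by ext; simp
  map_mul' σ τ := by ext; simp [mul_smul]

/-- A tableau of shape `μ` on `N` letters: a bijective filling of the boxes of `μ`. -/
abbrev Tableau (μ : YoungDiagram) (N : ℕ) : Type := {c // c ∈ μ.cells} ≃ Fin N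

/-- The action of `S_N` on tableaux by permuting the letters. -/
def Tableau.perm {μ : YoungDiagram} {N : ℕ} (σ : Equiv.Perm (Fin N)) (t : Tableau μ N) :
    Tableau μ N := t.trans σ

/-- The tabloid `{t}` of a tableau `t`: the row containing each letter. -/
def Tableau.tabloid {μ : YoungDiagram} {N : ℕ} (t : Tableau μ N) : Tabloid μ N :=
  ⟨fun x => (t.symm x).1.1, fun i => by
    rw [YoungDiagram.rowLen_eq_card]
    refine Finset.card_bij (fun x _ => (t.symm x).1) ?_ ?_ ?_
    · intro x hx
      rw [YoungDiagram.mem_row_iff]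
      exact ⟨(YoungDiagram.mem_cells _).1 (t.symm x).2, (Finset.mem_filter.1 hx).2⟩
    · intro x _ y _ h
      exact t.symm.injective (Subtype.ext h)
    · intro c hc
      rw [YoungDiagram.mem_row_iff] at hc
      exact ⟨t ⟨c, (YoungDiagram.mem_cells _).2 hc.1⟩, by simp [hc.2], by simp⟩⟩

/-- The column (index) containing the letter `x` in the tableau `t`. -/
def Tableau.col {μ : YoungDiagram} {N : ℕ} (t : Tableau μ N) (x : Fin N) : ℕ := (t.symm x).1.2

/-- The polytabloid `e_t = ∑ sign(π) π{t}`, summed over the column stabilizer of `t`. -/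
def Tableau.polytabloid {μ : YoungDiagram} {N : ℕ} (t : Tableau μ N) : Tabloid μ N →₀ ℂ :=
  ∑ π : Equiv.Perm (Fin N) with ∀ x, t.col (π x) = t.col x,
    Finsupp.single (π • t.tabloid) ((Equiv.Perm.sign π : ℤ) : ℂ)

/-- Permuting the letters of `t` permutes the polytabloid: `σ e_t = e_{σ t}`. -/
theorem tabloidRep_polytabloid {μ : YoungDiagram} {N : ℕ} (σ : Equiv.Perm (Fin N))
    (t : Tableau μ N) : tabloidRep μ N σ t.polytabloid = (t.perm σ).polytabloid := by
  have hcol : ∀ x, (t.perm σ).col x = t.col (σ⁻¹ x) := fun _ => rfl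
  have htab : (t.perm σ).tabloid = σ • t.tabloid := rfl
  have happ : tabloidRep μ N σ t.polytabloid =
      Finsupp.lmapDomain ℂ ℂ (fun r => σ • r) t.polytabloid := rfl
  rw [happ, Tableau.polytabloid, Tableau.polytabloid, map_sum]
  refine Finset.sum_equiv (MulAut.conj σ).toEquiv ?_ ?_
  · intro π
    simp only [Finset.mem_filter, Finset.mem_univ, true_and, hcol, MulEquiv.toEquiv_eq_coe,
      EquivLike.coe_coe, MulAut.conj_apply, Equiv.Perm.mul_apply]
    constructor
    · intro h x
      simpa using h (σ⁻¹ x)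
    · intro h x
      simpa using h (σ x)
  · intro π _
    have hsign : Equiv.Perm.sign ((MulAut.conj σ).toEquiv π) = Equiv.Perm.sign π := by
      simp [mul_comm, ← mul_assoc]
    have hact : (MulAut.conj σ).toEquiv π • (t.perm σ).tabloid = σ • π • t.tabloid := by
      simp [htab, ← mul_smul]
    rw [hsign, hact]
    simp

/-- The Specht module `S^μ`: the span of the polytabloids inside `M^μ`. -/
def spechtModule (μ : YoungDiagram) (N : ℕ) : Subrepresentation (tabloidRep μ N) where
  toSubmodule := Submodule.span ℂ (Set.range fun t : Tableau μ N => t.polytabloid)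
  apply_mem_toSubmodule σ v hv := by
    induction hv using Submodule.span_induction with
    | mem v h =>
      obtain ⟨t, rfl⟩ := h
      rw [tabloidRep_polytabloid]
      exact Submodule.subset_span ⟨t.perm σ, rfl⟩
    | zero => simp
    | add v w _ _ hv hw => rw [map_add]; exact add_mem hv hw
    | smul a v _ hv => rw [map_smul]; exact Submodule.smul_mem _ a hv

/-! ## Multiplicities and partition patterns -/

/-- The multiplicity of an irreducible representation `σ` in `ρ`: the number of irreducible
constituents (the length) of the `σ`-isotypic component of `ρ`, which is the sum of all
subrepresentations of `ρ` isomorphic to `σ`. -/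
def irrepMultiplicity {G V W : Type*} [Group G] [AddCommGroup V] [Module ℂ V] [AddCommGroup W]
    [Module ℂ W] (σ : Representation ℂ G W) (ρ : Representation ℂ G V) : ℕ∞ :=
  Module.length ℂ[G] (isotypicComponent ℂ[G] ρ.asModule σ.asModule)

/-- `μ` is a partition of `N` represented by the pattern `(*, l)`: its list of
(positive, weakly decreasing) parts is `a :: l` for some first part `a`. -/
def HasPattern (N : ℕ) (l : List ℕ) (μ : YoungDiagram) : Prop :=
  μ.card = N ∧ ∃ a : ℕ, μ.rowLens = a :: l

/-- The multiplicity of `S^μ` in `Ind_{C_{3,n}}^{S_{3n}}(1)`, for `μ` a partition of `3n`. -/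
def mult (μ : YoungDiagram) (n : ℕ) : ℕ∞ :=
  irrepMultiplicity (W := (spechtModule μ (3 * n)).toSubmodule)
    (spechtModule μ (3 * n)).toRepresentation (inducedTrivial 3 n)

end

end BV

/-! By Frobenius reciprocity, the multiplicity of $S^\mu$ in $V_n$ is the dimension of the space of
$C_{3,n}$-fixed vectors of $S^\mu$. So it has to be shown that this space is zero, or is exactly a
line. Irreducibility of $S^\mu$, which the second case needs, comes from James's argument with the
signed column sum $\kappa_t$ (`kappa_mem_span`, `isIrreducible_specht`).

Upper bound. A vector of $S^\mu\subseteq M^\mu$ is a function on labellings of the points by row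
indices, and it satisfies one linear relation for each pair of rows $i<j$ and each labelling
(`raising_specht`). If it is fixed by $C_{3,n}$, it is a symmetric function of $n$ unordered blocks
of three labels (`IsHighestWeight`). The relations with $i=0$ make it vanish as soon as it vanishes
on the labellings in which no block has exactly one nonzero label
(`IsHighestWeight.eq_zero_of_reduced`). There are $|\lambda|\le 6$ nonzero labels, so at most three
blocks of such a labelling are nonzero. This leaves at most five normal forms, and a few relations
with $i\ge 1$ kill all of them (the vanishing patterns) or express them all through one (the
others).

Lower bound. Average a polytabloid $e_t$ over $C_{3,n}$. The average is nonzero if some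
$C_{3,n}$-invariant statistic of labellings is changed by every odd column permutation of $t$, for
then an invariant functional takes a positive value on $e_t$ (`exists_invariant_specht`). The
statistic is `blockStat`. Only the columns of length at least two matter; their letters are placed
at explicit points among the first $15$, which is where $n\ge 5$ enters, and the condition becomes a
finite check independent of $n$. -/

namespace BV

noncomputable section

/-! ### Multiplicities through intertwining maps. -/

section Multiplicity

variable {G V W : Type*} [Group G] [Finite G] [AddCommGroup V] [Module ℂ V] [AddCommGroup W]
  [Module ℂ W] {σ : Representation ℂ G W} {ρ : Representation ℂ G V}

theorem exists_isCompl_subrepresentation (U : Subrepresentation σ) : ∃ U', IsCompl U U' :=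
  (inferInstance : Representation.IsSemisimpleRepresentation σ).exists_isCompl U

/-- A submodule isomorphic to `σ` is the image of a projection onto `σ`. -/
theorem exists_linearMap_of_linearEquiv (m : Submodule ℂ[G] ρ.asModule)
    (e : m ≃ₗ[ℂ[G]] σ.asModule) :
    ∃ f : Representation.IntertwiningMap ρ σ, ∀ x : m, f (x : ρ.asModule) = e x := by
  obtain ⟨p, hp⟩ := MonoidAlgebra.exists_leftInverse_of_injective m.subtype m.ker_subtype
  refine ⟨(Representation.IntertwiningMap.equivLinearMapAsModule ρ σ).symm
    (e.toLinearMap ∘ₗ p), fun x => ?_⟩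
  change (e.toLinearMap ∘ₗ p) (m.subtype x) = e x
  have := LinearMap.congr_fun hp x
  exact congrArg e this

theorem irrepMultiplicity_eq_zero [Nontrivial W]
    (h : ∀ f : Representation.IntertwiningMap ρ σ, ∀ v, f v = 0) :
    irrepMultiplicity σ ρ = 0 := by
  have : isotypicComponent ℂ[G] ρ.asModule σ.asModule = ⊥ := by
    rw [isotypicComponent, sSup_eq_bot]
    rintro m ⟨e⟩
    obtain ⟨f, hf⟩ := exists_linearMap_of_linearEquiv m e
    rw [Submodule.eq_bot_iff]
    intro x hx
    have h1 : e ⟨x, hx⟩ = 0 := by rw [← hf ⟨x, hx⟩]; exact h f x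
    simpa using h1
  rw [irrepMultiplicity, this]
  exact Module.length_eq_zero

/-- The map `f` is injective on the isotypic component. Otherwise its kernel there contains a copy
of `σ`; by semisimplicity the isomorphism of that copy with `σ` extends to an intertwiner `g` on all
of `ρ`, and `g`, a multiple of `f`, would vanish on the copy. Hence the length is at most one, and a
nonzero `f` splits off at least one copy. -/
theorem irrepMultiplicity_eq_one [IsSimpleModule ℂ[G] σ.asModule]
    (f : Representation.IntertwiningMap ρ σ) (hf : ∃ v, f v ≠ 0)
    (h : ∀ g : Representation.IntertwiningMap ρ σ, ∃ c : ℂ, ∀ v, g v = c • f v) :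
    irrepMultiplicity σ ρ = 1 := by
  set F := Representation.IntertwiningMap.equivLinearMapAsModule ρ σ f with hF
  have hFf : ∀ v, F v = f v := fun v => rfl
  set I := isotypicComponent ℂ[G] ρ.asModule σ.asModule with hI
  have hiso : IsIsotypicOfType ℂ[G] I σ.asModule := .isotypicComponent _ _ _
  have hinj : Function.Injective (F ∘ₗ I.subtype) := by
    rw [← LinearMap.ker_eq_bot]
    refine (IsSemisimpleModule.eq_bot_or_exists_simple_le _).resolve_right ?_
    rintro ⟨k, hk, hks⟩
    obtain ⟨e⟩ := hiso k
    let e' := (k.equivMapOfInjective _ I.subtype_injective).symm.trans e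
    obtain ⟨g, hg⟩ := exists_linearMap_of_linearEquiv _ e'
    obtain ⟨c, hc⟩ := h g
    have := IsSimpleModule.nontrivial ℂ[G] k
    obtain ⟨x, hx⟩ := exists_ne (0 : k)
    have h1 := hg (k.equivMapOfInjective _ I.subtype_injective x)
    have h2 : f (((k.equivMapOfInjective _ I.subtype_injective) x : ρ.asModule)) = 0 :=
      hk x.2
    replace h1 := ((hc _).symm.trans h1).symm.trans ((congrArg (c • ·) h2).trans (smul_zero c))
    simp only [e', LinearEquiv.trans_apply, LinearEquiv.symm_apply_apply] at h1
    exact hx (e.map_eq_zero_iff.1 h1)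
  have hle : Module.length ℂ[G] I ≤ 1 := by
    rw [← Module.length_eq_one ℂ[G] σ.asModule]
    exact Module.length_le_of_injective _ hinj
  have hne : Nontrivial I := by
    rw [Submodule.nontrivial_iff_ne_bot]
    obtain ⟨v, hv⟩ := hf
    have hF0 : F ≠ 0 := fun h0 => hv ((hFf v).symm.trans (by rw [h0]; rfl))
    obtain ⟨s, ⟨e⟩⟩ := F.linearEquiv_of_ne_zero hF0
    have hs : s ≤ I := le_sSup ⟨e.symm⟩
    rintro hb
    rw [hb, le_bot_iff] at hs
    have := IsSimpleModule.nontrivial ℂ[G] σ.asModule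
    have := e.toEquiv.symm.nontrivial
    exact (Submodule.nontrivial_iff_ne_bot.1 this) hs
  refine le_antisymm hle ?_
  rw [irrepMultiplicity, Order.one_le_iff_pos]
  exact Module.length_pos

end Multiplicity

/-! ### Frobenius reciprocity for the induced trivial representation. -/

section Frobenius

open Representation

variable {G W : Type*} [Group G] [AddCommGroup W] [Module ℂ W] (σ : Representation ℂ G W)
  (C : Subgroup G)

/-- The vector of the representation induced from the trivial one at the identity coset. -/
def indOne : IndV C.subtype (Representation.trivial ℂ C ℂ) :=
  IndV.mk C.subtype (Representation.trivial ℂ C ℂ) 1 1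

variable {σ C}

/-- The translates of `indOne C` span the induced representation. -/
theorem intertwining_ext {f g : IntertwiningMap (ind C.subtype (Representation.trivial ℂ C ℂ)) σ}
    (h : f (indOne C) = g (indOne C)) : ∀ v, f v = g v := by
  have : f.toLinearMap = g.toLinearMap := by
    refine IndV.hom_ext _ _ fun x => ?_
    refine LinearMap.ext_ring ?_
    have h1 : IndV.mk C.subtype (Representation.trivial ℂ C ℂ) x 1 =
        ind C.subtype (Representation.trivial ℂ C ℂ) x⁻¹ (indOne C) := by
      rw [indOne, ind_mk]; simp
    simp only [LinearMap.comp_apply, h1]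
    exact (f.isIntertwining _ _ _ _).trans ((congrArg _ h).trans (g.isIntertwining _ _ _ _).symm)
  intro v
  exact LinearMap.congr_fun this v

theorem apply_indOne_invariant
    (f : IntertwiningMap (ind C.subtype (Representation.trivial ℂ C ℂ)) σ) {c : G} (hc : c ∈ C) :
    σ c (f (indOne C)) = f (indOne C) := by
  rw [← f.isIntertwining]
  congr 1
  rw [indOne, ind_mk]
  have := Coinvariants.mk_inv_tmul (k := ℂ) ((leftRegular ℂ G).comp C.subtype) (Representation.trivial ℂ C ℂ)
  have := this (MonoidAlgebra.single 1 1) 1 ⟨c, hc⟩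
  simpa using this

theorem exists_intertwining {w : W} (hw : ∀ c ∈ C, σ c w = w) :
    ∃ f : IntertwiningMap (ind C.subtype (Representation.trivial ℂ C ℂ)) σ,
      f (indOne C) = w := by
  refine ⟨⟨Coinvariants.lift _
    (TensorProduct.lift <| (Finsupp.lift _ _ _ fun h => σ h⁻¹ ∘ₗ LinearMap.toSpanSingleton ℂ W w) ∘ₗ
      (MonoidAlgebra.coeffLinearEquiv ℂ).toLinearMap)
    fun g ↦ by
      ext h
      simpa using congrArg (σ h⁻¹) (hw _ (inv_mem g.2)), fun g ↦ by ext; simp⟩, ?_⟩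
  simp [indOne]

end Frobenius

section

variable {G W : Type*} [Group G] [Finite G] [AddCommGroup W] [Module ℂ W]
  {σ : Representation ℂ G W} {C : Subgroup G}

theorem irrepMultiplicity_ind_eq_zero [Nontrivial W]
    (h : ∀ w : W, (∀ c ∈ C, σ c w = w) → w = 0) :
    irrepMultiplicity σ (Representation.ind C.subtype (Representation.trivial ℂ C ℂ)) = 0 := by
  refine irrepMultiplicity_eq_zero fun f v => ?_
  exact intertwining_ext (g := 0) (h _ fun c hc => apply_indOne_invariant f hc) v

theorem irrepMultiplicity_ind_eq_one [Representation.IsIrreducible σ] {w : W} (hw : w ≠ 0)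
    (hwC : ∀ c ∈ C, σ c w = w)
    (h : ∀ w' : W, (∀ c ∈ C, σ c w' = w') → ∃ a : ℂ, w' = a • w) :
    irrepMultiplicity σ (Representation.ind C.subtype (Representation.trivial ℂ C ℂ)) = 1 := by
  obtain ⟨f, hf⟩ := exists_intertwining hwC
  refine irrepMultiplicity_eq_one f ⟨_, hf.trans_ne hw⟩ fun g => ?_
  obtain ⟨a, ha⟩ := h _ fun c hc => apply_indOne_invariant g hc
  exact ⟨a, intertwining_ext (f := g) (g := a • f) (by rw [ha, ← hf]; rfl)⟩

end

end

end BV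

namespace BV

noncomputable section

/-! ### Specht modules: James's argument for irreducibility. -/

section Specht

variable {μ : YoungDiagram} {N : ℕ}

/-- The permutations preserving the columns of a tableau. -/
def Tableau.colStab (t : Tableau μ N) : Finset (Equiv.Perm (Fin N)) :=
  Finset.univ.filter fun π => ∀ x, t.col (π x) = t.col x

theorem Tableau.mem_colStab {t : Tableau μ N} {π : Equiv.Perm (Fin N)} :
    π ∈ t.colStab ↔ ∀ x, t.col (π x) = t.col x := by
  simp [Tableau.colStab]

theorem Tableau.one_mem_colStab (t : Tableau μ N) : 1 ∈ t.colStab :=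
  mem_colStab.2 fun _ => rfl

theorem Tableau.mul_mem_colStab {t : Tableau μ N} {π τ : Equiv.Perm (Fin N)}
    (hπ : π ∈ t.colStab) (hτ : τ ∈ t.colStab) : π * τ ∈ t.colStab :=
  mem_colStab.2 fun x => (mem_colStab.1 hπ _).trans (mem_colStab.1 hτ x)

theorem Tableau.inv_mem_colStab {t : Tableau μ N} {π : Equiv.Perm (Fin N)}
    (hπ : π ∈ t.colStab) : π⁻¹ ∈ t.colStab :=
  mem_colStab.2 fun x => by
    have := mem_colStab.1 hπ (π⁻¹ x)
    rw [← this]; simp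

theorem Tableau.swap_mem_colStab {t : Tableau μ N} {x y : Fin N} (h : t.col x = t.col y) :
    Equiv.swap x y ∈ t.colStab :=
  mem_colStab.2 fun z => by
    rw [Equiv.swap_apply_def]
    split_ifs with h1 h2
    · rw [h1, h]
    · rw [h2, h]
    · rfl

theorem Tableau.ext_row_col {t : Tableau μ N} {x y : Fin N}
    (hr : t.tabloid.1 x = t.tabloid.1 y) (hc : t.col x = t.col y) : x = y :=
  t.symm.injective (Subtype.ext (Prod.ext hr hc))

theorem smul_tabloid_apply (π : Equiv.Perm (Fin N)) (r : Tabloid μ N) (x : Fin N) :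
    (π • r).1 x = r.1 (π⁻¹ x) := rfl

/-- A letter is determined by its row and column, and column permutations do not change the column.
-/
theorem Tableau.eq_of_smul_tabloid_eq {t : Tableau μ N} {π τ : Equiv.Perm (Fin N)}
    (hπ : π ∈ t.colStab) (hτ : τ ∈ t.colStab) (h : π • t.tabloid = τ • t.tabloid) : π = τ := by
  have h1 : π⁻¹ = τ⁻¹ := by
    ext1 x
    refine t.ext_row_col (congrFun (congrArg Subtype.val h) x) ?_
    rw [mem_colStab.1 (inv_mem_colStab hπ), mem_colStab.1 (inv_mem_colStab hτ)]
  exact inv_injective h1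

theorem tabloidRep_single (σ : Equiv.Perm (Fin N)) (r : Tabloid μ N) (a : ℂ) :
    tabloidRep μ N σ (Finsupp.single r a) = Finsupp.single (σ • r) a := by
  change Finsupp.lmapDomain ℂ ℂ (fun r => σ • r) _ = _
  simp

theorem Tableau.polytabloid_eq (t : Tableau μ N) :
    t.polytabloid = ∑ π ∈ t.colStab,
      Finsupp.single (π • t.tabloid) ((Equiv.Perm.sign π : ℤ) : ℂ) := rfl

/-- The signed column sum `κ_t` acting on `M^μ`. -/
def Tableau.kappa (t : Tableau μ N) : (Tabloid μ N →₀ ℂ) →ₗ[ℂ] (Tabloid μ N →₀ ℂ) :=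
  ∑ π ∈ t.colStab, ((Equiv.Perm.sign π : ℤ) : ℂ) • tabloidRep μ N π

theorem Tableau.kappa_single (t : Tableau μ N) (r : Tabloid μ N) :
    t.kappa (Finsupp.single r 1) = ∑ π ∈ t.colStab,
      Finsupp.single (π • r) ((Equiv.Perm.sign π : ℤ) : ℂ) := by
  simp [kappa, tabloidRep_single]

theorem Tableau.kappa_tabloid (t : Tableau μ N) :
    t.kappa (Finsupp.single t.tabloid 1) = t.polytabloid := by
  rw [kappa_single, polytabloid_eq]

theorem Tableau.kappa_smul (t : Tableau μ N) {τ : Equiv.Perm (Fin N)} (hτ : τ ∈ t.colStab)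
    (r : Tabloid μ N) :
    t.kappa (Finsupp.single (τ • r) 1) =
      ((Equiv.Perm.sign τ : ℤ) : ℂ) • t.kappa (Finsupp.single r 1) := by
  rw [kappa_single, kappa_single, Finset.smul_sum]
  refine Finset.sum_equiv (Equiv.mulRight τ) (fun π => ?_) (fun π hπ => ?_)
  · refine ⟨fun h => mul_mem_colStab h hτ, fun h => ?_⟩
    simpa using mul_mem_colStab h (inv_mem_colStab hτ)
  · rcases Int.units_eq_one_or (Equiv.Perm.sign τ) with h | h <;>
      simp [mul_smul, h]

theorem Tableau.kappa_polytabloid (t : Tableau μ N) :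
    t.kappa t.polytabloid = (t.colStab.card : ℂ) • t.polytabloid := by
  nth_rewrite 1 [polytabloid_eq]
  rw [map_sum]
  have : ∀ π ∈ t.colStab, t.kappa
      (Finsupp.single (π • t.tabloid) ((Equiv.Perm.sign π : ℤ) : ℂ)) = t.polytabloid := by
    intro π hπ
    have h1 : Finsupp.single (π • t.tabloid) ((Equiv.Perm.sign π : ℤ) : ℂ) =
      ((Equiv.Perm.sign π : ℤ) : ℂ) • Finsupp.single (π • t.tabloid) (1 : ℂ) := by simp
    rw [h1, map_smul, kappa_smul t hπ, kappa_tabloid, smul_smul]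
    rcases Int.units_eq_one_or (Equiv.Perm.sign π) with h | h <;> simp [h]
  rw [Finset.sum_congr rfl this, Finset.sum_const, Nat.cast_smul_eq_nsmul]

theorem Tableau.colStab_card_ne_zero (t : Tableau μ N) : (t.colStab.card : ℂ) ≠ 0 := by
  rw [Nat.cast_ne_zero]
  exact Finset.card_ne_zero_of_mem t.one_mem_colStab

/-- The transposition of `x` and `y` fixes `r` and is an odd column permutation, so the value equals
its own negative. -/
theorem Tableau.kappa_single_eq_zero {t : Tableau μ N} {r : Tabloid μ N} {x y : Fin N}
    (hxy : x ≠ y) (hc : t.col x = t.col y) (hr : r.1 x = r.1 y) :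
    t.kappa (Finsupp.single r 1) = 0 := by
  have h1 : Equiv.swap x y • r = r := by
    refine Subtype.ext (funext fun z => ?_)
    rw [smul_tabloid_apply, Equiv.swap_inv, Equiv.swap_apply_def]
    split_ifs with h h
    · rw [h, hr]
    · rw [h, hr]
    · rfl
  have h2 := t.kappa_smul (swap_mem_colStab hc) r
  rw [h1, Equiv.Perm.sign_swap hxy] at h2
  have h3 : (2 : ℂ) • t.kappa (Finsupp.single r 1) = 0 := by
    rw [two_smul]
    nth_rewrite 1 [h2]
    simp
  simpa using h3

/-- If column `c` has fewer than `i` boxes, then `t` has all its letters in rows below index `i`.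
Otherwise `t` has at least `i` of them there, while `r`, being injective on the column, has at most
`i`. -/
theorem Tableau.card_row_lt_col_le {t : Tableau μ N} {r : Tabloid μ N}
    (h : ∀ x y, t.col x = t.col y → r.1 x = r.1 y → x = y) (i c : ℕ) :
    (Finset.univ.filter fun x => r.1 x < i ∧ t.col x = c).card ≤
      (Finset.univ.filter fun x => t.tabloid.1 x < i ∧ t.col x = c).card := by
  by_cases hic : ∃ k < i, (k, c) ∉ μ
  · refine Finset.card_le_card fun x hx => ?_
    simp only [Finset.mem_filter, Finset.mem_univ, true_and] at hx ⊢
    refine ⟨?_, hx.2⟩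
    obtain ⟨k, hk, hkc⟩ := hic
    by_contra hlt
    refine hkc (μ.isLowerSet ?_ (YoungDiagram.mem_cells _ |>.1 (t.symm x).2))
    exact ⟨hk.le.trans (not_lt.1 hlt), hx.2.ge⟩
  · push Not at hic
    have h1 : (Finset.univ.filter fun x => r.1 x < i ∧ t.col x = c).card ≤ i := by
      have := Finset.card_le_card_of_injOn (s := Finset.univ.filter fun x =>
        r.1 x < i ∧ t.col x = c) (t := Finset.range i) r.1
        (fun x hx => by simp at hx; simp [hx.1])
        (fun x hx y hy hxy => by
          simp at hx hy
          exact h x y (hx.2.trans hy.2.symm) hxy)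
      simpa using this
    refine h1.trans ?_
    have := Finset.card_le_card_of_injOn (s := (Finset.range i).attach) (t := Finset.univ.filter fun x =>
        t.tabloid.1 x < i ∧ t.col x = c)
        (fun k => t ⟨(k.1, c), (YoungDiagram.mem_cells _).2 (hic k.1 (Finset.mem_range.1 k.2))⟩)
        (fun k _ => by
          simp only [Finset.coe_filter, Set.mem_ofPred_eq, Finset.mem_univ, true_and]
          simp only [Tableau.tabloid, Tableau.col, Equiv.symm_apply_apply, and_true]
          exact Finset.mem_range.1 k.2)
        (fun k _ l _ hkl => by
          have := t.injective hkl
          simp only [Subtype.mk.injEq, Prod.mk.injEq, and_true] at this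
          exact Subtype.ext this)
    simpa using this

theorem Tableau.card_filter_row_lt (r s : Tabloid μ N) (i : ℕ) :
    (Finset.univ.filter fun x => r.1 x < i).card = (Finset.univ.filter fun x => s.1 x < i).card := by
  have key : ∀ r : Tabloid μ N, (Finset.univ.filter fun x => r.1 x < i).card =
      ∑ k ∈ Finset.range i, μ.rowLen k := by
    intro r
    rw [Finset.card_eq_sum_card_fiberwise (f := r.1) (t := Finset.range i)
      (fun x hx => by simpa using hx)]
    refine Finset.sum_congr rfl fun k hk => ?_
    rw [← r.2 k, Finset.filter_filter]
    congr 1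
    ext x
    simp only [Finset.mem_filter, Finset.mem_univ, true_and, and_iff_right_iff_imp]
    rintro rfl
    exact Finset.mem_range.1 hk
  rw [key, key]

/-- The columnwise inequalities of `card_row_lt_col_le` add up to an equality, since both tabloids
have shape `μ`; hence each is an equality. A letter that `r` puts beyond the end of its column would
make one of them strict. -/
theorem Tableau.mem_of_injective_on_columns {t : Tableau μ N} {r : Tabloid μ N}
    (h : ∀ x y, t.col x = t.col y → r.1 x = r.1 y → x = y) (x : Fin N) :
    (r.1 x, t.col x) ∈ μ := by
  by_contra hx
  set i := r.1 x with hi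
  set c := t.col x with hc
  have hcol : ∀ s : Tabloid μ N, (Finset.univ.filter fun x => s.1 x < i).card =
      ∑ d ∈ Finset.univ.image t.col,
          (Finset.univ.filter fun x => s.1 x < i ∧ t.col x = d).card := by
    intro s
    rw [Finset.card_eq_sum_card_fiberwise (f := t.col) (t := Finset.univ.image t.col)
      (fun x _ => by simp)]
    refine Finset.sum_congr rfl fun k hk => ?_
    rw [Finset.filter_filter]
  have h1 := Tableau.card_filter_row_lt r t.tabloid i
  rw [hcol, hcol] at h1
  have h2 := (Finset.sum_eq_sum_iff_of_le (fun d _ => t.card_row_lt_col_le h i d)).1 h1 c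
    (by simp [hc])
  have h3 : (Finset.univ.filter fun x => r.1 x < i ∧ t.col x = c) ⊂
      (Finset.univ.filter fun x => t.tabloid.1 x < i ∧ t.col x = c) := by
    rw [Finset.ssubset_iff_of_subset]
    · refine ⟨x, ?_, ?_⟩
      · simp only [Finset.mem_filter, Finset.mem_univ, true_and, hc, and_true]
        by_contra hlt
        refine hx (μ.isLowerSet ?_ (YoungDiagram.mem_cells _ |>.1 (t.symm x).2))
        exact ⟨not_lt.1 hlt, le_rfl⟩
      · simp [hi]
    · intro y hy
      simp only [Finset.mem_filter, Finset.mem_univ, true_and] at hy ⊢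
      refine ⟨?_, hy.2⟩
      by_contra hlt
      refine hx (μ.isLowerSet ?_ (YoungDiagram.mem_cells _ |>.1 (t.symm y).2))
      exact ⟨not_lt.1 hlt, hy.2.ge⟩
  exact (Finset.card_lt_card h3).ne h2

theorem Tableau.exists_smul_tabloid_eq {t : Tableau μ N} {r : Tabloid μ N}
    (h : ∀ x y, t.col x = t.col y → r.1 x = r.1 y → x = y) :
    ∃ π ∈ t.colStab, r = π • t.tabloid := by
  let f : Fin N → Fin N := fun x =>
    t ⟨(r.1 x, t.col x), (YoungDiagram.mem_cells _).2 (t.mem_of_injective_on_columns h x)⟩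
  have hcol : ∀ x, t.col (f x) = t.col x := fun x => by simp [f, Tableau.col]
  have hrow : ∀ x, t.tabloid.1 (f x) = r.1 x := fun x => by simp [f, Tableau.tabloid]
  have hf : Function.Injective f := fun x y hxy =>
    h x y (by rw [← hcol x, ← hcol y, hxy]) (by rw [← hrow x, ← hrow y, hxy])
  let π := Equiv.ofBijective f (Finite.injective_iff_bijective.1 hf)
  have hπ : π ∈ t.colStab := mem_colStab.2 hcol
  refine ⟨π⁻¹, inv_mem_colStab hπ, Subtype.ext (funext fun x => ?_)⟩
  rw [smul_tabloid_apply, inv_inv]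
  exact (hrow x).symm

/-- A tabloid either repeats a row within a column of `t`, and is killed, or is a column
rearrangement of `{t}`, and gives `± e_t`. -/
theorem Tableau.kappa_mem_span (t : Tableau μ N) (v : Tabloid μ N →₀ ℂ) :
    ∃ a : ℂ, t.kappa v = a • t.polytabloid := by
  induction v using Finsupp.induction_linear with
  | zero => exact ⟨0, by simp⟩
  | add v w hv hw =>
    obtain ⟨a, ha⟩ := hv
    obtain ⟨b, hb⟩ := hw
    exact ⟨a + b, by rw [map_add, ha, hb, add_smul]⟩
  | single r b =>
    have hb : Finsupp.single r b = b • Finsupp.single r (1 : ℂ) := by simp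
    rw [hb, map_smul]
    by_cases h : ∀ x y, t.col x = t.col y → r.1 x = r.1 y → x = y
    · obtain ⟨π, hπ, rfl⟩ := t.exists_smul_tabloid_eq h
      rw [kappa_smul t hπ, kappa_tabloid, smul_smul]
      exact ⟨_, rfl⟩
    · push Not at h
      obtain ⟨x, y, hc, hr, hxy⟩ := h
      exact ⟨0, by rw [kappa_single_eq_zero hxy hc hr]; simp⟩

theorem Tableau.polytabloid_ne_zero (t : Tableau μ N) : t.polytabloid ≠ 0 := by
  classical
  intro h
  have h1 : t.polytabloid t.tabloid = 1 := by
    rw [polytabloid_eq, Finsupp.finsetSum_apply, Finset.sum_eq_single 1]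
    · simp
    · intro π hπ hne
      rw [Finsupp.single_apply, if_neg]
      intro heq
      exact hne (eq_of_smul_tabloid_eq hπ t.one_mem_colStab (by rw [heq, one_smul]))
    · intro h; exact absurd t.one_mem_colStab h
  rw [h] at h1
  simp at h1

theorem Tableau.polytabloid_mem (t : Tableau μ N) :
    t.polytabloid ∈ (spechtModule μ N).toSubmodule :=
  Submodule.subset_span ⟨t, rfl⟩

theorem Tableau.nontrivial_specht (t : Tableau μ N) :
    Nontrivial (spechtModule μ N).toSubmodule :=
  ⟨⟨⟨_, t.polytabloid_mem⟩, 0, fun h => t.polytabloid_ne_zero (congrArg Subtype.val h)⟩⟩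

theorem exists_tableau (h : μ.card = N) : Nonempty (Tableau μ N) := by
  refine ⟨Fintype.equivOfCardEq ?_⟩
  rw [Fintype.card_coe, Fintype.card_fin]
  exact h

/-- The symmetric group is transitive on tableaux, so a single polytabloid generates the Specht
module. -/
theorem Tableau.eq_top_of_mem (t : Tableau μ N)
    (U : Subrepresentation (spechtModule μ N).toRepresentation)
    (h : ⟨t.polytabloid, t.polytabloid_mem⟩ ∈ U) : U = ⊤ := by
  have key : ∀ v (hv : v ∈ (spechtModule μ N).toSubmodule), (⟨v,
      hv⟩ : (spechtModule μ N).toSubmodule) ∈ U.toSubmodule := by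
    intro v hv
    have : (spechtModule μ N).toSubmodule ≤ U.toSubmodule.map (spechtModule μ N).toSubmodule.subtype := by
      refine Submodule.span_le.2 ?_
      rintro _ ⟨s, rfl⟩
      refine ⟨⟨s.polytabloid, s.polytabloid_mem⟩, ?_, rfl⟩
      have hs : s = t.perm (t.symm.trans s) := by
        ext x; simp [Tableau.perm]
      have := U.apply_mem_toSubmodule (t.symm.trans s) h
      have h2 : (spechtModule μ N).toRepresentation (t.symm.trans s)
          ⟨t.polytabloid, t.polytabloid_mem⟩ = ⟨s.polytabloid, s.polytabloid_mem⟩ := by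
        refine Subtype.ext ?_
        change tabloidRep μ N (t.symm.trans s) t.polytabloid = s.polytabloid
        rw [tabloidRep_polytabloid, ← hs]
      rw [h2] at this
      exact this
    obtain ⟨w, hw, rfl⟩ := this hv
    exact hw
  refine SetLike.ext fun v => ⟨fun _ => trivial, fun _ => key v.1 v.2⟩

theorem kappa_mem_subrep (t : Tableau μ N)
    (U : Subrepresentation (spechtModule μ N).toRepresentation)
    {u : (spechtModule μ N).toSubmodule} (hu : u ∈ U.toSubmodule) :
    ∃ w ∈ U.toSubmodule, (w : Tabloid μ N →₀ ℂ) = t.kappa u := by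
  refine ⟨∑ π ∈ t.colStab, ((Equiv.Perm.sign π : ℤ) : ℂ) • (spechtModule μ N).toRepresentation π u,
    Submodule.sum_mem _ fun π _ => Submodule.smul_mem _ _ (U.apply_mem_toSubmodule π hu), ?_⟩
  rw [Tableau.kappa, LinearMap.sum_apply, Submodule.coe_sum]
  rfl

/-- Specht modules are irreducible. -/
theorem isIrreducible_specht (h : μ.card = N) :
    Representation.IsIrreducible (V := (spechtModule μ N).toSubmodule)
      (spechtModule μ N).toRepresentation := by
  obtain ⟨t⟩ := exists_tableau h
  have hnt := t.nontrivial_specht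
  have : Nontrivial (Subrepresentation (spechtModule μ N).toRepresentation) := by
    refine ⟨⊥, ⊤, fun hbt => ?_⟩
    have h1 := congrArg Subrepresentation.toSubmodule hbt
    exact bot_ne_top (α := Submodule ℂ (spechtModule μ N).toSubmodule) h1
  refine ⟨fun U => ?_⟩
  -- Complete reducibility replaces James's bilinear form: write $e_t=u+u'$ along $U\oplus U'$. As
  -- $\kappa_t e_t$ is a nonzero multiple of $e_t$, one of $\kappa_t u$, $\kappa_t u'$ is nonzero,
  -- hence a nonzero multiple of $e_t$ lying in that summand.
  obtain ⟨U', hU⟩ := exists_isCompl_subrepresentation (W := (spechtModule μ N).toSubmodule) U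
  have hcodis : (⟨t.polytabloid, t.polytabloid_mem⟩ : (spechtModule μ N).toSubmodule) ∈
      (U ⊔ U').toSubmodule := by
    rw [hU.sup_eq_top]; trivial
  obtain ⟨u, hu, u', hu', huu⟩ := Submodule.mem_sup.1 hcodis
  have key : ∀ (X : Subrepresentation (spechtModule μ N).toRepresentation)
      (x : (spechtModule μ N).toSubmodule), x ∈ X.toSubmodule → t.kappa x ≠ 0 → X = ⊤ := by
    intro X x hx hne
    obtain ⟨a, ha⟩ := t.kappa_mem_span x
    obtain ⟨w, hw, hwx⟩ := kappa_mem_subrep t X hx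
    have ha0 : a ≠ 0 := by rintro rfl; exact hne (by rw [ha, zero_smul])
    refine t.eq_top_of_mem X ?_
    have : (⟨t.polytabloid, t.polytabloid_mem⟩ : (spechtModule μ N).toSubmodule) = a⁻¹ • w := by
      refine Subtype.ext ?_
      change t.polytabloid = a⁻¹ • (w : Tabloid μ N →₀ ℂ)
      rw [hwx, ha, smul_smul, inv_mul_cancel₀ ha0, one_smul]
    rw [this]
    exact Submodule.smul_mem X.toSubmodule _ hw
  by_cases h1 : t.kappa u = 0
  · left
    have h2 : t.kappa u' ≠ 0 := by
      intro h2
      have h3 : t.kappa t.polytabloid = 0 := by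
        have := congrArg (fun z : (spechtModule μ N).toSubmodule => t.kappa (z : Tabloid μ N →₀ ℂ)) huu
        simp only [Submodule.coe_add, map_add, h1, h2, add_zero] at this
        exact this.symm
      rw [t.kappa_polytabloid] at h3
      exact (smul_ne_zero t.colStab_card_ne_zero t.polytabloid_ne_zero) h3
    have := key U' u' hu' h2
    rw [this] at hU
    simpa using hU.inf_eq_bot
  · right
    exact key U u hu h1

/-! ### Coefficients of tabloids and the raising relations -/

/-- The coefficient in `v` of the tabloid with row function `r`, zero if there is none. -/
def coeff (v : Tabloid μ N →₀ ℂ) (r : Fin N → ℕ) : ℂ :=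
  Finsupp.mapDomain (fun s : Tabloid μ N => s.1) v r

theorem coeff_zero (r : Fin N → ℕ) : coeff (0 : Tabloid μ N →₀ ℂ) r = 0 := by
  rw [coeff, Finsupp.mapDomain_zero]
  rfl

theorem coeff_add (v w : Tabloid μ N →₀ ℂ) (r : Fin N → ℕ) :
    coeff (v + w) r = coeff v r + coeff w r := by
  rw [coeff, Finsupp.mapDomain_add]
  rfl

theorem coeff_smul (a : ℂ) (v : Tabloid μ N →₀ ℂ) (r : Fin N → ℕ) :
    coeff (a • v) r = a * coeff v r := by
  rw [coeff, Finsupp.mapDomain_smul]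
  rfl

theorem coeff_apply (v : Tabloid μ N →₀ ℂ) (r : Tabloid μ N) : coeff v r.1 = v r := by
  exact Finsupp.mapDomain_apply Subtype.val_injective v r

theorem coeff_eq_zero (v : Tabloid μ N →₀ ℂ) {r : Fin N → ℕ} {i : ℕ}
    (h : (Finset.univ.filter fun x => r x = i).card ≠ μ.rowLen i) : coeff v r = 0 := by
  refine Finsupp.mapDomain_of_notMem_range _ _ ?_
  rintro ⟨s, rfl⟩
  exact h (s.2 i)

theorem eq_zero_of_coeff {v : Tabloid μ N →₀ ℂ} (h : ∀ r, coeff v r = 0) : v = 0 :=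
  Finsupp.ext fun r => by rw [← coeff_apply, h]; rfl

theorem coeff_tabloidRep (σ : Equiv.Perm (Fin N)) (v : Tabloid μ N →₀ ℂ) (r : Fin N → ℕ) :
    coeff (tabloidRep μ N σ v) r = coeff v (r ∘ σ) := by
  classical
  induction v using Finsupp.induction_linear with
  | zero => simp [coeff_zero]
  | add v w hv hw => rw [map_add, coeff_add, coeff_add, hv, hw]
  | single s a =>
    rw [tabloidRep_single]
    simp only [coeff, Finsupp.mapDomain_single, Finsupp.single_apply]
    congr 1
    refine propext ⟨?_, ?_⟩
    · rintro rfl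
      funext x; simp [smul_tabloid_apply]
    · intro h
      funext x; simp [smul_tabloid_apply, h]

theorem Tableau.coeff_polytabloid (t : Tableau μ N) (r : Fin N → ℕ) :
    coeff t.polytabloid r =
      ∑ π ∈ t.colStab with (π • t.tabloid).1 = r, ((Equiv.Perm.sign π : ℤ) : ℂ) := by
  classical
  simp only [coeff, polytabloid_eq, Finsupp.mapDomain_finsetSum, Finsupp.finsetSum_apply,
    Finsupp.mapDomain_single, Finsupp.single_apply, Finset.sum_filter]

/-- The terms are pairs `(x, π)` in which `π • {t}` has `x` in row `j` and agrees with `r`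
elsewhere. Exchanging `x` with the letter in row `i` of the same column is a sign-reversing
involution on these pairs. -/
theorem Tableau.raising_polytabloid (t : Tableau μ N) {i j : ℕ} (hij : i < j) (r : Fin N → ℕ) :
    ∑ x with r x = i, coeff t.polytabloid (Function.update r x j) = 0 := by
  classical
  simp only [coeff_polytabloid]
  rw [Finset.sum_sigma']
  -- The partner of `x`. For the pairs that occur, the box in row `i` exists because the column
  -- reaches row `j > i`; the other branch is never used.
  let y : Fin N → Equiv.Perm (Fin N) → Fin N := fun x π =>
    if h : (i, t.col x) ∈ μ.cells then π (t ⟨(i, t.col x), h⟩) else x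
  have main : ∀ x (π : Equiv.Perm (Fin N)), π ∈ t.colStab →
      (π • t.tabloid).1 = Function.update r x j →
      t.col (y x π) = t.col x ∧ (π • t.tabloid).1 (y x π) = i ∧ y x π ≠ x ∧ r (y x π) = i := by
    intro x π hπ hx
    have h1 : t.tabloid.1 (π⁻¹ x) = j := by
      rw [← smul_tabloid_apply, hx]; simp
    have h2 : t.col (π⁻¹ x) = t.col x := mem_colStab.1 (inv_mem_colStab hπ) x
    have h3 : (i, t.col x) ∈ μ.cells := by
      rw [YoungDiagram.mem_cells]
      refine μ.isLowerSet ?_ (YoungDiagram.mem_cells _ |>.1 (t.symm (π⁻¹ x)).2)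
      exact ⟨hij.le.trans h1.ge, h2.ge⟩
    have h4 : y x π = π (t ⟨(i, t.col x), h3⟩) := dif_pos h3
    have h5 : (π • t.tabloid).1 (y x π) = i := by
      rw [h4, smul_tabloid_apply]; simp [Tableau.tabloid]
    have h6 : y x π ≠ x := by
      intro h
      rw [h, smul_tabloid_apply, h1] at h5
      omega
    refine ⟨?_, h5, h6, ?_⟩
    · rw [h4, mem_colStab.1 hπ]; simp [Tableau.col]
    · rw [hx, Function.update_of_ne h6] at h5
      exact h5
  refine Finset.sum_involution (fun p _ => ⟨y p.1 p.2, Equiv.swap p.1 (y p.1 p.2) * p.2⟩)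
    ?_ ?_ ?_ ?_
  · rintro ⟨x, π⟩ hp
    simp only [Finset.mem_sigma, Finset.mem_filter, Finset.mem_univ, true_and] at hp
    obtain ⟨-, -, h3, -⟩ := main x π hp.2.1 hp.2.2
    simp [Equiv.Perm.sign_mul, Equiv.Perm.sign_swap h3.symm]
  · rintro ⟨x, π⟩ hp _ heq
    simp only [Finset.mem_sigma, Finset.mem_filter, Finset.mem_univ, true_and] at hp
    exact (main x π hp.2.1 hp.2.2).2.2.1 (congrArg Sigma.fst heq)
  · rintro ⟨x, π⟩ hp
    simp only [Finset.mem_sigma, Finset.mem_filter, Finset.mem_univ, true_and] at hp ⊢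
    obtain ⟨h1, h2, h3, h4⟩ := main x π hp.2.1 hp.2.2
    refine ⟨h4, mul_mem_colStab (swap_mem_colStab h1.symm) hp.2.1, ?_⟩
    funext z
    rw [mul_smul, smul_tabloid_apply, Equiv.swap_inv, hp.2.2, Equiv.swap_apply_def]
    split_ifs with hz hz'
    · rw [hz, Function.update_of_ne h3, Function.update_of_ne h3.symm, h4, hp.1]
    · rw [hz']; simp
    · rw [Function.update_of_ne hz, Function.update_of_ne hz']
  · rintro ⟨x, π⟩ hp
    simp only [Finset.mem_sigma, Finset.mem_filter, Finset.mem_univ, true_and] at hp ⊢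
    obtain ⟨h1, h2, h3, h4⟩ := main x π hp.2.1 hp.2.2
    have h5 : y (y x π) (Equiv.swap x (y x π) * π) = x := by
      have h6 : (i, t.col x) ∈ μ.cells := by
        by_contra h6
        exact h3 (dif_neg h6)
      have h7 : y x π = π (t ⟨(i, t.col x), h6⟩) := dif_pos h6
      have h8 : (i, t.col (y x π)) ∈ μ.cells := by rw [h1]; exact h6
      have h9 : y (y x π) (Equiv.swap x (y x π) * π) =
        (Equiv.swap x (y x π) * π) (t ⟨(i, t.col (y x π)), h8⟩) := dif_pos h8
      rw [h9, Equiv.Perm.mul_apply]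
      simp only [h1, ← h7, Equiv.swap_apply_right]
    rw [h5, ← mul_assoc, Equiv.swap_comm, Equiv.swap_mul_self, one_mul]

/-- Vectors of the Specht module are killed by the raising operators. -/
theorem raising_specht {v : Tabloid μ N →₀ ℂ} (hv : v ∈ (spechtModule μ N).toSubmodule)
    {i j : ℕ} (hij : i < j) (r : Fin N → ℕ) :
    ∑ x with r x = i, coeff v (Function.update r x j) = 0 := by
  induction hv using Submodule.span_induction with
  | mem v h =>
    obtain ⟨t, rfl⟩ := h
    exact t.raising_polytabloid hij r
  | zero => simp [coeff_zero]
  | add v w _ _ hv hw => simp only [coeff_add, Finset.sum_add_distrib, hv, hw, add_zero]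
  | smul a v _ hv => simp only [coeff_smul, ← Finset.mul_sum, hv, mul_zero]

end Specht

end

end BV

namespace BV

noncomputable section

/-! ### Functions on block-labellings -/

/-- The position of a point: its block and its place in the block. -/
def blockEquiv (n : ℕ) : Fin (3 * n) ≃ Fin n × Fin 3 :=
  (finCongr (Nat.mul_comm 3 n)).trans finProdFinEquiv.symm

theorem blockEquiv_fst (n : ℕ) (x : Fin (3 * n)) : ((blockEquiv n x).1 : ℕ) = (x : ℕ) / 3 := by
  simp [blockEquiv, finProdFinEquiv]

/-- The permutation of the points permuting the blocks by `σ` and each block `b` by `τ b`. -/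
def blockPerm {n : ℕ} (σ : Equiv.Perm (Fin n)) (τ : Fin n → Equiv.Perm (Fin 3)) :
    Equiv.Perm (Fin (3 * n)) :=
  (blockEquiv n).trans ((Equiv.prodShear σ τ).trans (blockEquiv n).symm)

theorem blockPerm_mem {n : ℕ} (σ : Equiv.Perm (Fin n)) (τ : Fin n → Equiv.Perm (Fin 3)) :
    blockPerm σ τ ∈ blockStabilizer 3 n := by
  intro x y
  have h : ∀ z, (blockPerm σ τ z : ℕ) / 3 = σ (blockEquiv n z).1 := fun z => by
    rw [← blockEquiv_fst]; simp [blockPerm]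
  rw [h, h, ← blockEquiv_fst, ← blockEquiv_fst, Fin.val_inj, Fin.val_inj, σ.injective.eq_iff]

/-- The functions on labellings of `n` blocks of size `3` that are symmetric in the blocks
and inside the blocks, are killed by the raising operators, and are supported on labellings
with exactly `l i` labels `i`. -/
structure IsHighestWeight (n : ℕ) (l : ℕ → ℕ) (F : (Fin n → Fin 3 → ℕ) → ℂ) : Prop where
  symm : ∀ (r : Fin n → Fin 3 → ℕ) (σ : Equiv.Perm (Fin n)) (τ : Fin n → Equiv.Perm (Fin 3)),
    F (fun b => r (σ b) ∘ τ b) = F r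
  raise : ∀ (r : Fin n → Fin 3 → ℕ) {i j : ℕ}, i < j →
    ∑ b, ∑ s, (if r b s = i then F (Function.update r b (Function.update (r b) s j)) else 0) = 0
  content : ∀ (r : Fin n → Fin 3 → ℕ), F r ≠ 0 →
    ∀ i, ∑ b, ∑ s, (if r b s = i then 1 else 0) = l i

variable {μ : YoungDiagram} {n : ℕ}

/-- The coefficient function of `v` on block labellings. -/
def blockCoeff (v : Tabloid μ (3 * n) →₀ ℂ) (r : Fin n → Fin 3 → ℕ) : ℂ :=
  coeff v (fun x => r (blockEquiv n x).1 (blockEquiv n x).2)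

theorem eq_zero_of_blockCoeff {v : Tabloid μ (3 * n) →₀ ℂ} (h : ∀ r, blockCoeff v r = 0) :
    v = 0 := by
  refine eq_zero_of_coeff fun r => ?_
  rw [← h fun b s => r ((blockEquiv n).symm (b, s))]
  simp [blockCoeff]

theorem isHighestWeight_blockCoeff {v : Tabloid μ (3 * n) →₀ ℂ}
    (hv : v ∈ (spechtModule μ (3 * n)).toSubmodule)
    (hC : ∀ c ∈ blockStabilizer 3 n, tabloidRep μ (3 * n) c v = v) :
    IsHighestWeight n μ.rowLen (blockCoeff v) where
  symm r σ τ := by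
    rw [blockCoeff, blockCoeff]
    nth_rewrite 2 [← hC _ (blockPerm_mem σ τ)]
    rw [coeff_tabloidRep]
    congr 1
    funext x
    simp [blockPerm]
  raise r i j hij := by
    refine Eq.trans ?_ (raising_specht hv hij fun x => r (blockEquiv n x).1 (blockEquiv n x).2)
    rw [Finset.sum_filter, ← Fintype.sum_prod_type']
    refine Finset.sum_equiv (blockEquiv n).symm (by simp) fun y _ => ?_
    simp only [Equiv.apply_symm_apply]
    split_ifs with h
    · rw [blockCoeff]
      congr 1
      funext x
      by_cases hx : x = (blockEquiv n).symm y
      · subst hx; simp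
      · rw [Function.update_of_ne hx]
        have hxy : blockEquiv n x ≠ y := fun h => hx (by rw [← h]; simp)
        by_cases h1 : (blockEquiv n x).1 = y.1
        · rw [h1, Function.update_self, Function.update_of_ne]
          exact fun h2 => hxy (Prod.ext h1 h2)
        · rw [Function.update_of_ne h1]
    · rfl
  content r hr i := by
    by_contra h
    refine hr (coeff_eq_zero v (i := i) ?_)
    rw [← ne_eq] at h
    convert h using 1
    rw [Finset.card_filter, ← Fintype.sum_prod_type']
    exact Finset.sum_equiv (blockEquiv n) (by simp) fun y _ => rfl

theorem IsHighestWeight.smul_sub {l : ℕ → ℕ} {F F' : (Fin n → Fin 3 → ℕ) → ℂ}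
    (h : IsHighestWeight n l F) (h' : IsHighestWeight n l F') (a : ℂ) :
    IsHighestWeight n l (fun r => F r - a * F' r) where
  symm r σ τ := by simp only [h.symm r σ τ, h'.symm r σ τ]
  raise r i j hij := by
    have h1 := h.raise r hij
    have h2 := h'.raise r hij
    have : ∀ b s, (if r b s = i then
        F (Function.update r b (Function.update (r b) s j)) -
          a * F' (Function.update r b (Function.update (r b) s j)) else 0) =
        (if r b s = i then F (Function.update r b (Function.update (r b) s j)) else 0) -
        a * (if r b s = i then F' (Function.update r b (Function.update (r b) s j)) else 0) := by
      intro b s; split_ifs <;> simp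
    simp only [this, Finset.sum_sub_distrib, ← Finset.mul_sum, h1, h2, mul_zero, sub_zero]
  content r hr i := by
    by_cases h0 : F r = 0
    · refine h'.content r (fun h1 => hr ?_) i
      simp [h0, h1]
    · exact h.content r h0 i

theorem mult_eq_zero (hμ : μ.card = 3 * n)
    (h : ∀ F, IsHighestWeight n μ.rowLen F → ∀ r, F r = 0) : mult μ n = 0 := by
  obtain ⟨t⟩ := exists_tableau hμ
  have := t.nontrivial_specht
  refine irrepMultiplicity_ind_eq_zero (W := (spechtModule μ (3 * n)).toSubmodule) ?_
  rintro ⟨w, hw⟩ hC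
  refine Subtype.ext (eq_zero_of_blockCoeff (h _ (isHighestWeight_blockCoeff hw ?_)))
  intro c hc
  exact congrArg Subtype.val (hC c hc)

/-- By `h`, evaluation at `r₀` is injective on highest weight functions, so fixed vectors form at
most a line: subtracting a suitable multiple of `v` makes the value at `r₀` zero. -/
theorem mult_eq_one (hμ : μ.card = 3 * n) {v : Tabloid μ (3 * n) →₀ ℂ}
    (hv : v ∈ (spechtModule μ (3 * n)).toSubmodule) (hv0 : v ≠ 0)
    (hC : ∀ c ∈ blockStabilizer 3 n, tabloidRep μ (3 * n) c v = v) (r₀ : Fin n → Fin 3 → ℕ)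
    (h : ∀ F, IsHighestWeight n μ.rowLen F → F r₀ = 0 → ∀ r, F r = 0) : mult μ n = 1 := by
  have := isIrreducible_specht hμ
  have hF := isHighestWeight_blockCoeff hv hC
  have h0 : blockCoeff v r₀ ≠ 0 := fun h0 => hv0 (eq_zero_of_blockCoeff (h _ hF h0))
  refine irrepMultiplicity_ind_eq_one (W := (spechtModule μ (3 * n)).toSubmodule)
    (w := ⟨v, hv⟩) (fun h => hv0 (congrArg Subtype.val h))
    (fun c hc => Subtype.ext (hC c hc)) ?_
  rintro ⟨w, hw⟩ hwC
  have hF' := isHighestWeight_blockCoeff hw fun c hc => congrArg Subtype.val (hwC c hc)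
  refine ⟨blockCoeff w r₀ / blockCoeff v r₀, Subtype.ext ?_⟩
  change w = (blockCoeff w r₀ / blockCoeff v r₀) • v
  have key := h _ (hF'.smul_sub hF (blockCoeff w r₀ / blockCoeff v r₀))
    (by rw [div_mul_cancel₀ _ h0, sub_self])
  rw [← sub_eq_zero, sub_eq_add_neg, ← neg_smul]
  refine eq_zero_of_blockCoeff fun r => ?_
  rw [← key r, blockCoeff, coeff_add, coeff_smul, neg_mul, ← sub_eq_add_neg]
  rfl

/-- If a statistic of row functions that is invariant under the block stabilizer separates
a tabloid from all its odd column rearrangements, then averaging the polytabloid gives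
a nonzero invariant vector. -/
theorem exists_invariant_specht (t : Tableau μ (3 * n)) (Q : (Fin (3 * n) → ℕ) → ℕ)
    (hQ : ∀ c ∈ blockStabilizer 3 n, ∀ r, Q (r ∘ c) = Q r)
    (h : ∀ π ∈ t.colStab, Q (π • t.tabloid).1 = Q t.tabloid.1 → Equiv.Perm.sign π = 1) :
    ∃ v ∈ (spechtModule μ (3 * n)).toSubmodule, v ≠ 0 ∧
      ∀ c ∈ blockStabilizer 3 n, tabloidRep μ (3 * n) c v = v := by
  classical
  let C := Finset.univ.filter fun c => c ∈ blockStabilizer 3 n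
  have hCm : ∀ c, c ∈ C ↔ c ∈ blockStabilizer 3 n := fun c => by simp [C]
  -- The sum of the coefficients of the tabloids with the same statistic as `{t}`. It is invariant
  -- under the block stabilizer, so it takes the value $|C|\,L(e_t)$ on the average, and $L(e_t)$
  -- merely counts column permutations, all signs involved being positive.
  let L : (Tabloid μ (3 * n) →₀ ℂ) →ₗ[ℂ] ℂ :=
    Finsupp.linearCombination ℂ fun r => if Q r.1 = Q t.tabloid.1 then (1 : ℂ) else 0
  have hL : ∀ c ∈ blockStabilizer 3 n, ∀ v, L (tabloidRep μ (3 * n) c v) = L v := by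
    intro c hc v
    induction v using Finsupp.induction_linear with
    | zero => simp
    | add v w hv hw => rw [map_add, map_add, map_add, hv, hw]
    | single r a =>
      rw [tabloidRep_single]
      have : (c • r).1 = r.1 ∘ (c⁻¹ : Equiv.Perm (Fin (3 * n))) := rfl
      simp only [L, Finsupp.linearCombination_single, this, hQ _ (inv_mem hc)]
  have hLe : L t.polytabloid ≠ 0 := by
    have : L t.polytabloid =
        ((t.colStab.filter fun π => Q (π • t.tabloid).1 = Q t.tabloid.1).card : ℂ) := by
      rw [Tableau.polytabloid_eq, map_sum, Finset.card_filter, Nat.cast_sum]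
      refine Finset.sum_congr rfl fun π hπ => ?_
      simp only [L, Finsupp.linearCombination_single]
      split_ifs with h1
      · simp [h π hπ h1]
      · simp
    rw [this, Nat.cast_ne_zero]
    exact Finset.card_ne_zero_of_mem (a := 1)
      (Finset.mem_filter.2 ⟨t.one_mem_colStab, by rw [one_smul]⟩)
  refine ⟨∑ c ∈ C, tabloidRep μ (3 * n) c t.polytabloid, ?_, ?_, ?_⟩
  · refine Submodule.sum_mem _ fun c _ => ?_
    exact (spechtModule μ (3 * n)).apply_mem_toSubmodule c t.polytabloid_mem
  · intro h0
    have h1 := congrArg L h0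
    rw [map_sum, Finset.sum_congr rfl (fun c hc => hL c ((hCm c).1 hc) t.polytabloid),
      Finset.sum_const, map_zero, smul_eq_zero] at h1
    refine h1.elim (fun h2 => ?_) hLe
    exact Finset.card_ne_zero_of_mem ((hCm 1).2 (one_mem _)) h2
  · intro c hc
    rw [map_sum]
    refine Finset.sum_equiv (Equiv.mulLeft c) (fun d => ?_) (fun d _ => ?_)
    · rw [hCm, hCm]
      exact (Subgroup.mul_mem_cancel_left _ hc).symm
    · simp

end

end BV

/-! ### Reduction to normal forms supported on at most three blocks. -/

namespace BV

noncomputable section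

variable {n : ℕ} {l : ℕ → ℕ} {F : (Fin n → Fin 3 → ℕ) → ℂ}

/-- A block is reduced if it does not have exactly one nonzero label. -/
def IsReduced (p : Fin 3 → ℕ) : Prop := ∀ s, p s ≠ 0 → ∃ s', s' ≠ s ∧ p s' ≠ 0

theorem IsHighestWeight.apply_update_single (hF : IsHighestWeight n l F) {r : Fin n → Fin 3 → ℕ}
    {b b' : Fin n} (hb : r b = 0) (hb' : r b' = 0) (s s' : Fin 3) (j : ℕ) :
    F (Function.update r b (Function.update (r b) s j)) =
      F (Function.update r b' (Function.update (r b') s' j)) := by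
  rw [← hF.symm _ (Equiv.swap b b') (fun c => if c = b' then Equiv.swap s s' else 1)]
  congr 1
  have hpos : ∀ x : Fin 3, Function.update (0 : Fin 3 → ℕ) s j (Equiv.swap s s' x) =
      Function.update (0 : Fin 3 → ℕ) s' j x := by
    intro x
    simp only [Function.update_apply, Equiv.swap_apply_eq_iff, Equiv.swap_apply_left]
    rfl
  rw [hb, hb']
  funext c x
  simp only [Function.comp_apply]
  by_cases hc : c = b'
  · subst hc
    rw [Equiv.swap_apply_right, Function.update_self, Function.update_self, if_pos rfl, hpos]
  · rw [Function.update_of_ne hc, if_neg hc]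
    by_cases hcb : c = b
    · subst hcb
      rw [Equiv.swap_apply_left, Function.update_of_ne (Ne.symm hc), hb, hb']
      rfl
    · rw [Equiv.swap_apply_of_ne_of_ne hcb hc, Function.update_of_ne hcb]
      rfl

/-- A highest weight function vanishes if it vanishes on the labellings with reduced blocks. -/
theorem IsHighestWeight.eq_zero_of_reduced (hF : IsHighestWeight n l F)
    (h : ∀ r, (∀ b, IsReduced (r b)) → F r = 0) (r : Fin n → Fin 3 → ℕ) : F r = 0 := by
  -- Induction on the number of nonzero blocks. Erase the single nonzero label `j` of a non-reduced
  -- block and use the relation for `0 < j` at the resulting `r'`.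
  induction hm : (Finset.univ.filter fun b => r b ≠ 0).card using Nat.strong_induction_on
    generalizing r with
  | _ m ih =>
  by_cases hr : ∀ b, IsReduced (r b)
  · exact h r hr
  unfold IsReduced at hr
  push Not at hr
  obtain ⟨b₀, s₀, hj, hs⟩ := hr
  set j := r b₀ s₀ with hjdef
  set r' := Function.update r b₀ 0 with hr'
  have hr'b : r' b₀ = 0 := by simp [hr']
  have hrr : Function.update r' b₀ (Function.update (r' b₀) s₀ j) = r := by
    funext b
    by_cases hb : b = b₀
    · subst hb
      rw [Function.update_self, hr'b]
      funext s
      by_cases hss : s = s₀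
      · subst hss; simp [hjdef]
      · rw [Function.update_of_ne hss, hs s hss]; rfl
    · rw [Function.update_of_ne hb, hr', Function.update_of_ne hb]
  -- Putting `j` into any zero block gives `F r` by symmetry. Putting it into a nonzero block gives
  -- a labelling with one nonzero block fewer than `r`.
  have key : ∀ b, ∑ s, (if r' b s = 0 then
      F (Function.update r' b (Function.update (r' b) s j)) else 0) =
      if r' b = 0 then 3 * F r else 0 := by
    intro b
    split_ifs with hb
    · have : ∀ s, (if r' b s = 0 then
          F (Function.update r' b (Function.update (r' b) s j)) else 0) = F r := by
        intro s
        rw [if_pos (by rw [hb]; rfl), hF.apply_update_single hb hr'b s s₀ j, hrr]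
      rw [Finset.sum_congr rfl fun s _ => this s]
      simp
    · refine Finset.sum_eq_zero fun s _ => ?_
      split_ifs with hs0
      · refine ih _ ?_ _ rfl
        rw [← hm]
        refine Finset.card_lt_card ?_
        rw [Finset.ssubset_iff_of_subset]
        · refine ⟨b₀, ?_, ?_⟩
          · simp only [Finset.mem_filter, Finset.mem_univ, true_and]
            exact fun h0 => hj (by rw [hjdef, h0]; rfl)
          · have hbb : b₀ ≠ b := by rintro rfl; exact hb hr'b
            simp [Function.update_of_ne hbb, hr'b]
        · intro c hc
          simp only [Finset.mem_filter, Finset.mem_univ, true_and] at hc ⊢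
          by_cases hcb : c = b
          · subst hcb
            have : c ≠ b₀ := by rintro rfl; exact hb hr'b
            rw [hr', Function.update_of_ne this] at hb
            exact hb
          · rw [Function.update_of_ne hcb] at hc
            by_cases hc0 : c = b₀
            · subst hc0; exact absurd hr'b hc
            · rwa [hr', Function.update_of_ne hc0] at hc
      · rfl
  have hsum := hF.raise r' (i := 0) (j := j) (Nat.pos_of_ne_zero hj)
  rw [Finset.sum_congr rfl fun b _ => key b, ← Finset.sum_filter, Finset.sum_const,
    nsmul_eq_mul] at hsum
  have hcard : ((Finset.univ.filter fun b => r' b = 0).card : ℂ) ≠ 0 := by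
    rw [Nat.cast_ne_zero]
    exact Finset.card_ne_zero_of_mem (a := b₀) (by simp [hr'b])
  simpa [hcard] using hsum

/-! ### Labellings supported on three blocks -/

/-- The labelling with blocks `p`, `q`, `s` followed by zero blocks. -/
def conf (n : ℕ) (p q s : Fin 3 → ℕ) (b : Fin n) : Fin 3 → ℕ :=
  if b.1 = 0 then p else if b.1 = 1 then q else if b.1 = 2 then s else 0

/-- The block with labels `p`. -/
def blockVec (p : ℕ × ℕ × ℕ) : Fin 3 → ℕ := ![p.1, p.2.1, p.2.2]

/-- The weakly decreasing reduced blocks with labels at most `3`. -/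
def reducedBlocks : List (ℕ × ℕ × ℕ) :=
  ((List.range 4).flatMap fun a => (List.range (a + 1)).flatMap fun b =>
    (List.range (b + 1)).map fun c => (a, b, c)).filter fun p => p.1 = 0 ∨ p.2.1 ≠ 0

/-- The number of labels `j` in a block. -/
def labelCount (j : ℕ) (p : ℕ × ℕ × ℕ) : ℕ :=
  (if p.1 = j then 1 else 0) + (if p.2.1 = j then 1 else 0) + (if p.2.2 = j then 1 else 0)

/-- A numerical code of blocks used to order them. -/
def blockCode (p : ℕ × ℕ × ℕ) : ℕ := 16 * p.1 + 4 * p.2.1 + p.2.2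

/-- The normal forms of reduced labellings with `l₁`, `l₂`, `l₃` labels `1`, `2`, `3`. -/
def configs (l₁ l₂ l₃ : ℕ) : List ((ℕ × ℕ × ℕ) × (ℕ × ℕ × ℕ) × (ℕ × ℕ × ℕ)) :=
  (reducedBlocks ×ˢ (reducedBlocks ×ˢ reducedBlocks)).filter fun c =>
    blockCode c.2.1 ≤ blockCode c.1 ∧ blockCode c.2.2 ≤ blockCode c.2.1 ∧
    labelCount 1 c.1 + labelCount 1 c.2.1 + labelCount 1 c.2.2 = l₁ ∧
    labelCount 2 c.1 + labelCount 2 c.2.1 + labelCount 2 c.2.2 = l₂ ∧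
    labelCount 3 c.1 + labelCount 3 c.2.1 + labelCount 3 c.2.2 = l₃

theorem mem_reducedBlocks {a b c : ℕ} (ha : a ≤ 3) (hb : b ≤ a) (hc : c ≤ b)
    (h : a ≠ 0 → b ≠ 0) : (a, b, c) ∈ reducedBlocks := by
  simp only [reducedBlocks, List.mem_filter, List.mem_flatMap, List.mem_range, List.mem_map,
    decide_eq_true_eq]
  refine ⟨⟨a, by omega, b, by omega, c, by omega, rfl⟩, ?_⟩
  by_cases h0 : a = 0
  · exact Or.inl h0
  · exact Or.inr (h h0)

theorem sum_conf {M : Type*} [AddCommMonoid M] (hn : 3 ≤ n) (p q s : Fin 3 → ℕ)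
    (f : Fin n → (Fin 3 → ℕ) → M) (hf : ∀ b, f b 0 = 0) :
    ∑ b, f b (conf n p q s b) =
      f ⟨0, by omega⟩ p + f ⟨1, by omega⟩ q + f ⟨2, by omega⟩ s := by
  obtain ⟨m, rfl⟩ := Nat.exists_eq_add_of_le' hn
  rw [Fin.sum_univ_succ, Fin.sum_univ_succ, Fin.sum_univ_succ, Finset.sum_eq_zero]
  · rw [add_zero, ← add_assoc]
    rfl
  · intro b _
    have : conf (m + 3) p q s b.succ.succ.succ = 0 := by simp [conf]
    rw [this, hf]

theorem exists_antitone_comp (p : Fin 3 → ℕ) :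
    ∃ τ : Equiv.Perm (Fin 3), p (τ 1) ≤ p (τ 0) ∧ p (τ 2) ≤ p (τ 1) := by
  refine ⟨Fin.revPerm.trans (Tuple.sort p), ?_, ?_⟩
  · exact Tuple.monotone_sort p (show Fin.rev (1 : Fin 3) ≤ Fin.rev 0 by decide)
  · exact Tuple.monotone_sort p (show Fin.rev (2 : Fin 3) ≤ Fin.rev 1 by decide)

theorem IsReduced.comp {p : Fin 3 → ℕ} (h : IsReduced p) (τ : Equiv.Perm (Fin 3)) :
    IsReduced (p ∘ τ) := by
  intro s hs
  obtain ⟨s', h1, h2⟩ := h (τ s) hs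
  exact ⟨τ.symm s', fun h => h1 (by rw [← h]; simp), by simpa using h2⟩

/-- A highest weight function with at most six nonzero labels vanishes if it vanishes
at the normal forms. -/
theorem IsHighestWeight.eq_zero_of_configs (hF : IsHighestWeight n l F) (hn : 3 ≤ n)
    (hl : ∀ j, 4 ≤ j → l j = 0) (hl6 : l 1 + l 2 + l 3 ≤ 6)
    (h : ∀ c ∈ configs (l 1) (l 2) (l 3),
      F (conf n (blockVec c.1) (blockVec c.2.1) (blockVec c.2.2)) = 0)
    (r : Fin n → Fin 3 → ℕ) : F r = 0 := by
  refine hF.eq_zero_of_reduced (fun r hr => ?_) r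
  by_contra hne
  choose τ hτ using fun b => exists_antitone_comp (r b)
  rw [← hF.symm r 1 τ] at hne
  set R : Fin n → Fin 3 → ℕ := fun b => r b ∘ τ b with hR
  change F R ≠ 0 at hne
  have hR1 : ∀ b, R b 1 ≤ R b 0 := fun b => (hτ b).1
  have hR2 : ∀ b, R b 2 ≤ R b 1 := fun b => (hτ b).2
  have hRr : ∀ b, R b 0 ≠ 0 → R b 1 ≠ 0 := by
    intro b hb h1
    obtain ⟨s', h2, h3⟩ := (hr b).comp (τ b) 0 hb
    change R b s' ≠ 0 at h3
    have := hR2 b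
    fin_cases s'
    · exact h2 rfl
    · exact h3 h1
    · exact h3 (by simp only [Fin.reduceFinMk]; omega)
  have hle : ∀ b s, R b s ≤ 3 := by
    intro b s
    by_contra hlt
    have h1 := hF.content R hne (R b s)
    rw [hl _ (by omega), Finset.sum_eq_zero_iff] at h1
    have h2 := h1 b (Finset.mem_univ _)
    rw [Finset.sum_eq_zero_iff] at h2
    simpa using h2 s (Finset.mem_univ _)
  set B := Finset.univ.filter fun b => R b 0 ≠ 0 with hB
  have hBcard : B.card ≤ 3 := by
    -- Each nonzero reduced block uses at least two of the at most six nonzero labels.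
    have h1 : ∑ b ∈ B, 2 ≤ ∑ b, ((∑ s, if R b s = 1 then 1 else 0) +
        (∑ s, if R b s = 2 then 1 else 0) + ∑ s, if R b s = 3 then 1 else 0) := by
      refine (Finset.sum_le_sum fun b hb => ?_).trans
        (Finset.sum_le_sum_of_subset (Finset.subset_univ B))
      have h0 : R b 0 ≠ 0 := (Finset.mem_filter.1 hb).2
      have h1 := hRr b h0
      have h2 := hle b 0
      have h3 := hle b 1
      simp only [Fin.sum_univ_three]
      generalize R b 0 = x at *
      generalize R b 1 = y at *
      have hx : x = 1 ∨ x = 2 ∨ x = 3 := by omega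
      have hy : y = 1 ∨ y = 2 ∨ y = 3 := by omega
      rcases hx with rfl | rfl | rfl <;> rcases hy with rfl | rfl | rfl <;> simp <;> omega
    rw [Finset.sum_add_distrib, Finset.sum_add_distrib, hF.content R hne, hF.content R hne,
      hF.content R hne, Finset.sum_const, smul_eq_mul] at h1
    omega
  obtain ⟨B', hBB, hB'⟩ := Finset.exists_superset_card_eq hBcard (by simpa using hn)
  let code : Fin n → ℕ := fun b => blockCode (R b 0, R b 1, R b 2)
  let y₀ : Fin 3 ↪ Fin n := (B'.orderEmbOfFin hB').toEmbedding
  let y : Fin 3 ↪ Fin n :=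
    (Fin.revPerm.trans (Tuple.sort (code ∘ y₀))).toEmbedding.trans y₀
  have hy : ∀ b, b ∉ Set.range y → R b = 0 := by
    intro b hb
    have hbB : b ∉ B := by
      intro hbB
      have : b ∈ Set.range (B'.orderEmbOfFin hB') := by
        rw [Finset.range_orderEmbOfFin]; exact hBB hbB
      obtain ⟨i, hi⟩ := this
      exact hb ⟨(Fin.revPerm.trans (Tuple.sort (code ∘ y₀))).symm i, by simpa [y, y₀] using hi⟩
    have h0 : R b 0 = 0 := by simpa [hB] using hbB
    have h1 := hR1 b
    have h2 := hR2 b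
    funext s
    fin_cases s
    · exact h0
    · change R b 1 = 0; omega
    · change R b 2 = 0; omega
  have hy1 : code (y 1) ≤ code (y 0) :=
    Tuple.monotone_sort (code ∘ y₀) (show Fin.rev (1 : Fin 3) ≤ Fin.rev 0 by decide)
  have hy2 : code (y 2) ≤ code (y 1) :=
    Tuple.monotone_sort (code ∘ y₀) (show Fin.rev (2 : Fin 3) ≤ Fin.rev 1 by decide)
  -- A permutation of the blocks moves the three chosen ones, in decreasing order of code, to the
  -- front.
  obtain ⟨σ, hσ⟩ := MulAction.isMultiplyPretransitive_iff.1
    (Equiv.Perm.isMultiplyPretransitive (Fin n) 3) (Fin.castLEEmb hn) y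
  have hσ' : ∀ i : Fin 3, σ (Fin.castLE hn i) = y i := fun i => by
    rw [← hσ]; rfl
  have hconf : (fun b => R (σ b) ∘ (1 : Equiv.Perm (Fin 3))) =
      conf n (R (y 0)) (R (y 1)) (R (y 2)) := by
    funext b
    change R (σ b) = _
    unfold conf
    split_ifs with h0 h1 h2
    · rw [← hσ' 0]; congr 2; exact Fin.ext h0
    · rw [← hσ' 1]; congr 2; exact Fin.ext h1
    · rw [← hσ' 2]; congr 2; exact Fin.ext h2
    · refine hy _ ?_
      rintro ⟨i, hi⟩
      rw [← hσ' i] at hi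
      have := congrArg Fin.val (σ.injective hi)
      simp only [Fin.val_castLE] at this
      have := i.2
      omega
  rw [← hF.symm R σ (fun _ => 1), hconf] at hne
  have hvec : ∀ b, R b = blockVec (R b 0, R b 1, R b 2) := by
    intro b
    funext s
    fin_cases s <;> rfl
  have hcount : ∀ j, j ≠ 0 → labelCount j (R (y 0) 0, R (y 0) 1, R (y 0) 2) +
      labelCount j (R (y 1) 0, R (y 1) 1, R (y 1) 2) +
      labelCount j (R (y 2) 0, R (y 2) 1, R (y 2) 2) = l j := by
    intro j hj
    rw [← hF.content _ hne j, sum_conf hn _ _ _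
      (fun _ p => ∑ s, if p s = j then 1 else 0) (fun b => by simp [hj.symm])]
    simp only [Fin.sum_univ_three, labelCount]
  rw [hvec (y 0), hvec (y 1), hvec (y 2)] at hne
  refine hne (h ((R (y 0) 0, R (y 0) 1, R (y 0) 2), (R (y 1) 0, R (y 1) 1, R (y 1) 2),
    (R (y 2) 0, R (y 2) 1, R (y 2) 2)) ?_)
  have hmem : ∀ b, (R b 0, R b 1, R b 2) ∈ reducedBlocks := fun b =>
    mem_reducedBlocks (hle b 0) (hR1 b) (hR2 b) (hRr b)
  simp only [configs, List.mem_filter, List.mem_product, hmem, decide_eq_true_eq, true_and]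
  exact ⟨hy1, hy2, hcount 1 (by decide), hcount 2 (by decide), hcount 3 (by decide)⟩

/-- The value of a function of labellings on a labelling supported on three blocks. -/
def confValue (F : (Fin n → Fin 3 → ℕ) → ℂ) (a b c d e f g h k : ℕ) : ℂ :=
  F (conf n ![a, b, c] ![d, e, f] ![g, h, k])

/-- Adjacent transpositions within blocks and of blocks generate all symmetries of three blocks.
Stated on nine explicit labels, they act in `simp only` as ordered rewriting rules that identify
equivalent values. -/
theorem IsHighestWeight.confValue_swap₁ (hF : IsHighestWeight n l F) (a b c d e f g h k : ℕ) :
    confValue F a b c d e f g h k = confValue F b a c d e f g h k := by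
  rw [confValue, confValue, ← hF.symm _ 1 (fun b => if b.1 = 0 then Equiv.swap 0 1 else 1)]
  congr 1
  funext b x
  rcases b with ⟨_ | b, hb⟩
  · fin_cases x <;> rfl
  · rfl

theorem IsHighestWeight.confValue_swap₂ (hF : IsHighestWeight n l F) (a b c d e f g h k : ℕ) :
    confValue F a b c d e f g h k = confValue F a c b d e f g h k := by
  rw [confValue, confValue, ← hF.symm _ 1 (fun b => if b.1 = 0 then Equiv.swap 1 2 else 1)]
  congr 1
  funext b x
  rcases b with ⟨_ | b, hb⟩
  · fin_cases x <;> rfl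
  · rfl

theorem IsHighestWeight.confValue_block₁ (hF : IsHighestWeight n l F) (hn : 3 ≤ n)
    (a b c d e f g h k : ℕ) :
    confValue F a b c d e f g h k = confValue F d e f a b c g h k := by
  rw [confValue, confValue,
    ← hF.symm _ (Equiv.swap ⟨0, by omega⟩ ⟨1, by omega⟩) (fun _ => 1)]
  congr 1
  funext b x
  simp only [conf, Equiv.Perm.one_apply, Function.comp_apply, Equiv.swap_apply_def, Fin.ext_iff]
  rcases b with ⟨_ | _ | _ | b, hb⟩ <;> simp

theorem IsHighestWeight.confValue_block₂ (hF : IsHighestWeight n l F) (hn : 3 ≤ n)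
    (a b c d e f g h k : ℕ) :
    confValue F a b c d e f g h k = confValue F a b c g h k d e f := by
  rw [confValue, confValue,
    ← hF.symm _ (Equiv.swap ⟨1, by omega⟩ ⟨2, by omega⟩) (fun _ => 1)]
  congr 1
  funext b x
  simp only [conf, Equiv.Perm.one_apply, Function.comp_apply, Equiv.swap_apply_def, Fin.ext_iff]
  rcases b with ⟨_ | _ | _ | b, hb⟩ <;> simp

theorem IsHighestWeight.confValue_swap₃ (hF : IsHighestWeight n l F) (hn : 3 ≤ n)
    (a b c d e f g h k : ℕ) :
    confValue F a b c d e f g h k = confValue F a b c e d f g h k := by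
  rw [hF.confValue_block₁ hn, hF.confValue_swap₁, hF.confValue_block₁ hn]

theorem IsHighestWeight.confValue_swap₄ (hF : IsHighestWeight n l F) (hn : 3 ≤ n)
    (a b c d e f g h k : ℕ) :
    confValue F a b c d e f g h k = confValue F a b c d f e g h k := by
  rw [hF.confValue_block₁ hn, hF.confValue_swap₂, hF.confValue_block₁ hn]

theorem IsHighestWeight.confValue_swap₅ (hF : IsHighestWeight n l F) (hn : 3 ≤ n)
    (a b c d e f g h k : ℕ) :
    confValue F a b c d e f g h k = confValue F a b c d e f h g k := by
  rw [hF.confValue_block₂ hn, hF.confValue_swap₃ hn, hF.confValue_block₂ hn]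

theorem IsHighestWeight.confValue_swap₆ (hF : IsHighestWeight n l F) (hn : 3 ≤ n)
    (a b c d e f g h k : ℕ) :
    confValue F a b c d e f g h k = confValue F a b c d e f g k h := by
  rw [hF.confValue_block₂ hn, hF.confValue_swap₄ hn, hF.confValue_block₂ hn]

theorem conf_update_zero (hn : 3 ≤ n) (p q s u : Fin 3 → ℕ) :
    Function.update (conf n p q s) ⟨0, by omega⟩ u = conf n u q s := by
  funext b
  rcases b with ⟨_ | _ | _ | b, hb⟩ <;> simp [conf]

theorem conf_update_one (hn : 3 ≤ n) (p q s u : Fin 3 → ℕ) :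
    Function.update (conf n p q s) ⟨1, by omega⟩ u = conf n p u s := by
  funext b
  rcases b with ⟨_ | _ | _ | b, hb⟩ <;> simp [conf]

theorem conf_update_two (hn : 3 ≤ n) (p q s u : Fin 3 → ℕ) :
    Function.update (conf n p q s) ⟨2, by omega⟩ u = conf n p q u := by
  funext b
  rcases b with ⟨_ | _ | _ | b, hb⟩ <;> simp [conf]

theorem update_vec_zero (a b c j : ℕ) : Function.update ![a, b, c] 0 j = ![j, b, c] := by
  funext x; fin_cases x <;> rfl

theorem update_vec_one (a b c j : ℕ) : Function.update ![a, b, c] 1 j = ![a, j, c] := by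
  funext x; fin_cases x <;> rfl

theorem update_vec_two (a b c j : ℕ) : Function.update ![a, b, c] 2 j = ![a, b, j] := by
  funext x; fin_cases x <;> rfl

/-- For `i ≠ 0` the zero blocks contribute nothing, so the relation is independent of `n`. The
relations with `i = 0` have been used in the reduction. -/
theorem IsHighestWeight.confValue_raise (hF : IsHighestWeight n l F) (hn : 3 ≤ n) {i j : ℕ}
    (hi : i ≠ 0) (hij : i < j) (a b c d e f g h k : ℕ) :
    ((if a = i then confValue F j b c d e f g h k else 0) +
      (if b = i then confValue F a j c d e f g h k else 0) +
      (if c = i then confValue F a b j d e f g h k else 0)) +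
    ((if d = i then confValue F a b c j e f g h k else 0) +
      (if e = i then confValue F a b c d j f g h k else 0) +
      (if f = i then confValue F a b c d e j g h k else 0)) +
    ((if g = i then confValue F a b c d e f j h k else 0) +
      (if h = i then confValue F a b c d e f g j k else 0) +
      (if k = i then confValue F a b c d e f g h j else 0)) = 0 := by
  have := hF.raise (conf n ![a, b, c] ![d, e, f] ![g, h, k]) hij
  rw [sum_conf hn _ _ _ (fun b' p => ∑ s, (if p s = i then
    F (Function.update (conf n ![a, b, c] ![d, e, f] ![g, h, k]) b'
      (Function.update p s j)) else 0)) (fun b' => by simp [hi.symm])] at this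
  simp only [Fin.sum_univ_three, conf_update_zero hn, conf_update_one hn, conf_update_two hn,
    update_vec_zero, update_vec_one, update_vec_two] at this
  exact this

end

end BV

/-! ### Solving the relations for each pattern. -/

namespace BV

noncomputable section

set_option linter.unusedSimpArgs false

variable {n : ℕ} {l : ℕ → ℕ} {F : (Fin n → Fin 3 → ℕ) → ℂ}

theorem IsHighestWeight.content_ne_zero (hF : IsHighestWeight n l F) {r : Fin n → Fin 3 → ℕ}
    (hr : F r ≠ 0) (b : Fin n) (s : Fin 3) : l (r b s) ≠ 0 := by
  rw [← hF.content r hr, Ne, Finset.sum_eq_zero_iff]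
  intro h
  have h2 := h b (Finset.mem_univ _)
  rw [Finset.sum_eq_zero_iff] at h2
  simpa using h2 s (Finset.mem_univ _)

/-- A highest weight function with a single nonzero label vanishes: in a reduced block every
nonzero label is accompanied by another one. -/
theorem IsHighestWeight.eq_zero_one (hF : IsHighestWeight n l F) (h1 : l 1 = 1)
    (h : ∀ j, 2 ≤ j → l j = 0) (r : Fin n → Fin 3 → ℕ) : F r = 0 := by
  refine hF.eq_zero_of_reduced (fun r hr => ?_) r
  by_contra hne
  have hle : ∀ b s, r b s ≤ 1 := fun b s => by
    by_contra hlt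
    exact hF.content_ne_zero hne b s (h _ (by omega))
  have hcon := hF.content r hne 1
  rw [h1] at hcon
  have : ∑ b, ∑ s, (if r b s = 1 then 1 else 0) ≠ 0 := by rw [hcon]; decide
  obtain ⟨b, -, hb⟩ := Finset.exists_ne_zero_of_sum_ne_zero this
  obtain ⟨s, -, hs⟩ := Finset.exists_ne_zero_of_sum_ne_zero hb
  have hs1 : r b s = 1 := by by_contra h; simp [h] at hs
  obtain ⟨s', hss, hs'⟩ := hr b s (by omega)
  have hs1' : r b s' = 1 := by have := hle b s'; omega
  have h2 : 2 ≤ ∑ s, (if r b s = 1 then 1 else 0) := by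
    rw [← Finset.card_filter, ← Finset.card_pair hss]
    refine Finset.card_le_card fun x hx => ?_
    rw [Finset.mem_insert, Finset.mem_singleton] at hx
    rcases hx with rfl | rfl <;> simp [*]
  have h3 := Finset.single_le_sum (f := fun b => ∑ s, (if r b s = 1 then 1 else 0))
    (fun _ _ => Nat.zero_le _) (Finset.mem_univ b)
  simp only [hcon] at h3
  omega

/-- Here `n = 2` can occur, so three-block normal forms are not available. Two nonzero reduced
blocks would need four nonzero labels, so the three labels form one block `{1, 1, 2}`. The relation
for `1 < 2` at a block `{1, 1, 1}` is three times that value. -/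
theorem IsHighestWeight.eq_zero_two_one (hF : IsHighestWeight n l F) (h1 : l 1 = 2)
    (h2 : l 2 = 1) (h : ∀ j, 3 ≤ j → l j = 0) (r : Fin n → Fin 3 → ℕ) : F r = 0 := by
  refine hF.eq_zero_of_reduced (fun r hr => ?_) r
  by_contra hne
  have hle : ∀ b s, r b s ≤ 2 := fun b s => by
    by_contra hlt
    exact hF.content_ne_zero hne b s (h _ (by omega))
  have hnz : ∑ b, ∑ s, (if r b s ≠ 0 then 1 else 0) = 3 := by
    refine Eq.trans ?_ (show l 1 + l 2 = 3 by omega)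
    rw [← hF.content r hne, ← hF.content r hne,
      ← Finset.sum_add_distrib]
    refine Finset.sum_congr rfl fun b _ => ?_
    rw [← Finset.sum_add_distrib]
    refine Finset.sum_congr rfl fun s _ => ?_
    have := hle b s
    interval_cases r b s <;> simp
  have hcon := hF.content r hne 2
  rw [h2] at hcon
  have : ∑ b, ∑ s, (if r b s = 2 then 1 else 0) ≠ 0 := by rw [hcon]; decide
  obtain ⟨b₀, -, hb⟩ := Finset.exists_ne_zero_of_sum_ne_zero this
  obtain ⟨s₀, -, hs⟩ := Finset.exists_ne_zero_of_sum_ne_zero hb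
  have hs2 : r b₀ s₀ = 2 := by by_contra h; simp [h] at hs
  have htwo : ∀ b s, r b s ≠ 0 → 2 ≤ ∑ s, (if r b s ≠ 0 then 1 else 0) := by
    intro b s hs
    obtain ⟨s', hss, hs'⟩ := hr b s hs
    rw [← Finset.card_filter, ← Finset.card_pair hss]
    refine Finset.card_le_card fun x hx => ?_
    rw [Finset.mem_insert, Finset.mem_singleton] at hx
    rcases hx with rfl | rfl <;> simp [*]
  have hz : ∀ b, b ≠ b₀ → r b = 0 := by
    intro b hbb
    by_contra hb0
    obtain ⟨s, hs⟩ := Function.ne_iff.1 hb0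
    have h3 := htwo b s hs
    have h4 := htwo b₀ s₀ (by omega)
    have h5 := Finset.sum_le_sum_of_subset (f := fun b => ∑ s, (if r b s ≠ 0 then 1 else 0))
      (Finset.subset_univ {b, b₀})
    rw [Finset.sum_pair hbb, hnz] at h5
    omega
  rw [Fintype.sum_eq_single b₀ (fun b hb => by simp [hz b hb])] at hnz hcon
  have hall : ∀ s, s ≠ s₀ → r b₀ s = 1 := by
    intro s hs
    have h3 : r b₀ s ≠ 0 := by
      intro h0
      have : ∑ s, (if r b₀ s ≠ 0 then 1 else 0) < ∑ _s : Fin 3, 1 :=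
        Finset.sum_lt_sum (fun s _ => by split_ifs <;> omega) ⟨s, Finset.mem_univ _, by simp [h0]⟩
      rw [hnz] at this
      simp at this
    have h4 : r b₀ s ≠ 2 := by
      intro h4
      have h5 := Finset.sum_le_sum_of_subset (f := fun s => if r b₀ s = 2 then 1 else 0)
        (Finset.subset_univ {s, s₀})
      rw [Finset.sum_pair hs, hcon] at h5
      simp [h4, hs2] at h5
    have := hle b₀ s
    omega
  have hrr : r = Function.update (0 : Fin n → Fin 3 → ℕ) b₀ (Function.update (1 : Fin 3 → ℕ) s₀ 2) := by
    funext b s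
    by_cases hb : b = b₀
    · subst hb
      rw [Function.update_self]
      by_cases hss : s = s₀
      · subst hss; simp [hs2]
      · simp [Function.update_of_ne hss, hall s hss]
    · rw [Function.update_of_ne hb, hz b hb]; rfl
  have hraise := hF.raise (Function.update 0 b₀ 1) (i := 1) (j := 2) (by decide)
  rw [Fintype.sum_eq_single b₀ (fun b hb => by simp [Function.update_of_ne hb])] at hraise
  have key : ∀ s, F (Function.update (0 : Fin n → Fin 3 → ℕ) b₀
      (Function.update (1 : Fin 3 → ℕ) s 2)) = F r := by
    intro s
    rw [hrr, ← hF.symm _ 1 (fun _ => Equiv.swap s s₀)]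
    congr 1
    funext b x
    by_cases hb : b = b₀
    · subst hb
      simp [Function.update_apply, Equiv.swap_apply_eq_iff]
    · simp [Function.update_of_ne hb]
  simp only [Function.update_self, Pi.one_apply, if_true, Function.update_idem, key] at hraise
  simp at hraise
  exact hne hraise

/-- Vanishing on the normal forms, expressed through `confValue`. -/
theorem IsHighestWeight.eq_zero_of_confValue (hF : IsHighestWeight n l F) (hn : 3 ≤ n)
    (hl : ∀ j, 4 ≤ j → l j = 0) (hl6 : l 1 + l 2 + l 3 ≤ 6)
    (h : ∀ c ∈ configs (l 1) (l 2) (l 3), confValue F c.1.1 c.1.2.1 c.1.2.2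
      c.2.1.1 c.2.1.2.1 c.2.1.2.2 c.2.2.1 c.2.2.2.1 c.2.2.2.2 = 0)
    (r : Fin n → Fin 3 → ℕ) : F r = 0 :=
  hF.eq_zero_of_configs hn hl hl6 h r

theorem IsHighestWeight.eq_zero_three_one (hF : IsHighestWeight n l F) (hn : 3 ≤ n)
    (h1 : l 1 = 3) (h2 : l 2 = 1) (h : ∀ j, 3 ≤ j → l j = 0)
    (r : Fin n → Fin 3 → ℕ) : F r = 0 := by
  have h3 := h 3 (by decide)
  refine hF.eq_zero_of_confValue hn (fun j hj => h j (by omega)) (by omega) ?_ r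
  rw [h1, h2, h3, show configs 3 1 0 = [((2, 1, 0), (1, 1, 0), 0, 0, 0)]
    by decide +kernel]
  simp only [List.mem_cons, List.not_mem_nil, or_false, forall_eq_or_imp, forall_eq]
  have e0 := hF.confValue_raise hn (i := 1) (j := 2) (by decide) (by decide) 1 1 0 1 1 0 0 0 0
  simp only [if_true, if_false, add_zero, zero_add, OfNat.ofNat_ne_one, OfNat.one_ne_ofNat,
    zero_ne_one, OfNat.zero_ne_ofNat] at e0
  simp only [hF.confValue_swap₁, hF.confValue_swap₂, hF.confValue_swap₃ hn,
    hF.confValue_swap₄ hn, hF.confValue_swap₅ hn, hF.confValue_swap₆ hn,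
    hF.confValue_block₁ hn, hF.confValue_block₂ hn] at e0 ⊢
  clear h
  grind

/-- Write values by their nonzero blocks. Relation `e2` is $3F(322|110)=0$; then `e3` gives
$F(321|210)=0$; then `e0` and `e4` give $F(310|221)=0$ and $F(311|220)=0$; finally `e1` gives
$F(320|211)=0$. -/
theorem IsHighestWeight.eq_zero_two_two_one (hF : IsHighestWeight n l F) (hn : 3 ≤ n)
    (h1 : l 1 = 2) (h2 : l 2 = 2) (h3 : l 3 = 1) (h : ∀ j, 4 ≤ j → l j = 0)
    (r : Fin n → Fin 3 → ℕ) : F r = 0 := by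
  refine hF.eq_zero_of_confValue hn (fun j hj => h j (by omega)) (by omega) ?_ r
  rw [h1, h2, h3, show configs 2 2 1 = [((3, 1, 0), (2, 2, 1), 0, 0, 0), ((3, 1, 1), (2, 2, 0), 0,
      0, 0), ((3, 2, 0), (2, 1, 1), 0, 0, 0),
    ((3, 2, 1), (2, 1, 0), 0, 0, 0), ((3, 2, 2), (1, 1, 0), 0, 0, 0)]
    by decide +kernel]
  simp only [List.mem_cons, List.not_mem_nil, or_false, forall_eq_or_imp, forall_eq]
  have e0 := hF.confValue_raise hn (i := 2) (j := 3) (by decide) (by decide) 2 1 0 2 2 1 0 0 0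
  have e1 := hF.confValue_raise hn (i := 2) (j := 3) (by decide) (by decide) 2 2 0 2 1 1 0 0 0
  have e2 := hF.confValue_raise hn (i := 2) (j := 3) (by decide) (by decide) 1 1 0 2 2 2 0 0 0
  have e3 := hF.confValue_raise hn (i := 1) (j := 2) (by decide) (by decide) 1 1 0 1 2 3 0 0 0
  have e4 := hF.confValue_raise hn (i := 1) (j := 2) (by decide) (by decide) 2 1 0 3 1 1 0 0 0
  simp only [if_true, if_false, add_zero, zero_add, OfNat.ofNat_ne_one, OfNat.one_ne_ofNat,
    zero_ne_one, OfNat.zero_ne_ofNat] at e0 e1 e2 e3 e4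
  simp only [hF.confValue_swap₁, hF.confValue_swap₂, hF.confValue_swap₃ hn,
    hF.confValue_swap₄ hn, hF.confValue_swap₅ hn, hF.confValue_swap₆ hn,
    hF.confValue_block₁ hn, hF.confValue_block₂ hn] at e0 e1 e2 e3 e4 ⊢
  clear h
  grind

/-- Relations `e1` and `e2` are $2F(320|111)=0$ and $2F(321|110)=0$; then `e3` kills $F(310|211)$,
and `e0` kills $F(311|210)$. -/
theorem IsHighestWeight.eq_zero_three_one_one (hF : IsHighestWeight n l F) (hn : 3 ≤ n)
    (h1 : l 1 = 3) (h2 : l 2 = 1) (h3 : l 3 = 1) (h : ∀ j, 4 ≤ j → l j = 0)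
    (r : Fin n → Fin 3 → ℕ) : F r = 0 := by
  refine hF.eq_zero_of_confValue hn (fun j hj => h j (by omega)) (by omega) ?_ r
  rw [h1, h2, h3, show configs 3 1 1 = [((3, 1, 0), (2, 1, 1), 0, 0, 0), ((3, 1, 1), (2, 1, 0), 0,
      0, 0), ((3, 2, 0), (1, 1, 1), 0, 0, 0),
    ((3, 2, 1), (1, 1, 0), 0, 0, 0)]
    by decide +kernel]
  simp only [List.mem_cons, List.not_mem_nil, or_false, forall_eq_or_imp, forall_eq]
  have e0 := hF.confValue_raise hn (i := 2) (j := 3) (by decide) (by decide) 2 1 0 2 1 1 0 0 0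
  have e1 := hF.confValue_raise hn (i := 2) (j := 3) (by decide) (by decide) 2 2 0 1 1 1 0 0 0
  have e2 := hF.confValue_raise hn (i := 2) (j := 3) (by decide) (by decide) 1 1 0 2 2 1 0 0 0
  have e3 := hF.confValue_raise hn (i := 1) (j := 2) (by decide) (by decide) 3 1 0 1 1 1 0 0 0
  simp only [if_true, if_false, add_zero, zero_add, OfNat.ofNat_ne_one, OfNat.one_ne_ofNat,
    zero_ne_one, OfNat.zero_ne_ofNat] at e0 e1 e2 e3
  simp only [hF.confValue_swap₁, hF.confValue_swap₂, hF.confValue_swap₃ hn,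
    hF.confValue_swap₄ hn, hF.confValue_swap₅ hn, hF.confValue_swap₆ hn,
    hF.confValue_block₁ hn, hF.confValue_block₂ hn] at e0 e1 e2 e3 ⊢
  clear h
  grind

/-- Replacing the `3` of a normal form by `2` yields two labels `2` that a symmetry exchanges, so
the relation for `2 < 3` is twice the value sought. -/
theorem IsHighestWeight.eq_zero_four_one_one (hF : IsHighestWeight n l F) (hn : 3 ≤ n)
    (h1 : l 1 = 4) (h2 : l 2 = 1) (h3 : l 3 = 1) (h : ∀ j, 4 ≤ j → l j = 0)
    (r : Fin n → Fin 3 → ℕ) : F r = 0 := by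
  refine hF.eq_zero_of_confValue hn (fun j hj => h j (by omega)) (by omega) ?_ r
  rw [h1, h2, h3, show configs 4 1 1 = [((3, 1, 0), (2, 1, 0), 1, 1, 0), ((3, 1, 1), (2, 1, 1), 0,
      0, 0), ((3, 2, 0), (1, 1, 0), 1, 1, 0),
    ((3, 2, 1), (1, 1, 1), 0, 0, 0)]
    by decide +kernel]
  simp only [List.mem_cons, List.not_mem_nil, or_false, forall_eq_or_imp, forall_eq]
  have e0 := hF.confValue_raise hn (i := 2) (j := 3) (by decide) (by decide) 2 1 0 2 1 0 1 1 0
  have e1 := hF.confValue_raise hn (i := 2) (j := 3) (by decide) (by decide) 2 1 1 2 1 1 0 0 0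
  have e2 := hF.confValue_raise hn (i := 2) (j := 3) (by decide) (by decide) 2 2 0 1 1 0 1 1 0
  have e3 := hF.confValue_raise hn (i := 2) (j := 3) (by decide) (by decide) 2 2 1 1 1 1 0 0 0
  simp only [if_true, if_false, add_zero, zero_add, OfNat.ofNat_ne_one, OfNat.one_ne_ofNat,
    zero_ne_one, OfNat.zero_ne_ofNat] at e0 e1 e2 e3
  simp only [hF.confValue_swap₁, hF.confValue_swap₂, hF.confValue_swap₃ hn,
    hF.confValue_swap₄ hn, hF.confValue_swap₅ hn, hF.confValue_swap₆ hn,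
    hF.confValue_block₁ hn, hF.confValue_block₂ hn] at e0 e1 e2 e3 ⊢
  clear h
  grind

theorem IsHighestWeight.eq_zero_nil_of (hF : IsHighestWeight n l F) (hn : 3 ≤ n)
    (h1 : l 1 = 0) (h : ∀ j, 2 ≤ j → l j = 0)
    (h0 : confValue F 0 0 0 0 0 0 0 0 0 = 0)
    (r : Fin n → Fin 3 → ℕ) : F r = 0 := by
  have h2 := h 2 le_rfl
  have h3 := h 3 (by decide)
  refine hF.eq_zero_of_confValue hn (fun j hj => h j (by omega)) (by omega) ?_ r
  rw [h1, h2, h3, show configs 0 0 0 = [((0, 0, 0), (0, 0, 0), 0, 0, 0)]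
    by decide +kernel]
  simp only [List.mem_cons, List.not_mem_nil, or_false, forall_eq_or_imp, forall_eq]
  exact h0

theorem IsHighestWeight.eq_zero_two_of (hF : IsHighestWeight n l F) (hn : 3 ≤ n)
    (h1 : l 1 = 2) (h : ∀ j, 2 ≤ j → l j = 0)
    (h0 : confValue F 1 1 0 0 0 0 0 0 0 = 0)
    (r : Fin n → Fin 3 → ℕ) : F r = 0 := by
  have h2 := h 2 le_rfl
  have h3 := h 3 (by decide)
  refine hF.eq_zero_of_confValue hn (fun j hj => h j (by omega)) (by omega) ?_ r
  rw [h1, h2, h3, show configs 2 0 0 = [((1, 1, 0), (0, 0, 0), 0, 0, 0)]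
    by decide +kernel]
  simp only [List.mem_cons, List.not_mem_nil, or_false, forall_eq_or_imp, forall_eq]
  exact h0

theorem IsHighestWeight.eq_zero_three_of (hF : IsHighestWeight n l F) (hn : 3 ≤ n)
    (h1 : l 1 = 3) (h : ∀ j, 2 ≤ j → l j = 0)
    (h0 : confValue F 1 1 1 0 0 0 0 0 0 = 0)
    (r : Fin n → Fin 3 → ℕ) : F r = 0 := by
  have h2 := h 2 le_rfl
  have h3 := h 3 (by decide)
  refine hF.eq_zero_of_confValue hn (fun j hj => h j (by omega)) (by omega) ?_ r
  rw [h1, h2, h3, show configs 3 0 0 = [((1, 1, 1), (0, 0, 0), 0, 0, 0)]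
    by decide +kernel]
  simp only [List.mem_cons, List.not_mem_nil, or_false, forall_eq_or_imp, forall_eq]
  exact h0

theorem IsHighestWeight.eq_zero_four_of (hF : IsHighestWeight n l F) (hn : 3 ≤ n)
    (h1 : l 1 = 4) (h : ∀ j, 2 ≤ j → l j = 0)
    (h0 : confValue F 1 1 0 1 1 0 0 0 0 = 0)
    (r : Fin n → Fin 3 → ℕ) : F r = 0 := by
  have h2 := h 2 le_rfl
  have h3 := h 3 (by decide)
  refine hF.eq_zero_of_confValue hn (fun j hj => h j (by omega)) (by omega) ?_ r
  rw [h1, h2, h3, show configs 4 0 0 = [((1, 1, 0), (1, 1, 0), 0, 0, 0)]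
    by decide +kernel]
  simp only [List.mem_cons, List.not_mem_nil, or_false, forall_eq_or_imp, forall_eq]
  exact h0

theorem IsHighestWeight.eq_zero_five_of (hF : IsHighestWeight n l F) (hn : 3 ≤ n)
    (h1 : l 1 = 5) (h : ∀ j, 2 ≤ j → l j = 0)
    (h0 : confValue F 1 1 1 1 1 0 0 0 0 = 0)
    (r : Fin n → Fin 3 → ℕ) : F r = 0 := by
  have h2 := h 2 le_rfl
  have h3 := h 3 (by decide)
  refine hF.eq_zero_of_confValue hn (fun j hj => h j (by omega)) (by omega) ?_ r
  rw [h1, h2, h3, show configs 5 0 0 = [((1, 1, 1), (1, 1, 0), 0, 0, 0)]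
    by decide +kernel]
  simp only [List.mem_cons, List.not_mem_nil, or_false, forall_eq_or_imp, forall_eq]
  exact h0

theorem IsHighestWeight.eq_zero_two_two_of (hF : IsHighestWeight n l F) (hn : 3 ≤ n)
    (h1 : l 1 = 2) (h2 : l 2 = 2) (h : ∀ j, 3 ≤ j → l j = 0)
    (h0 : confValue F 2 1 0 2 1 0 0 0 0 = 0)
    (r : Fin n → Fin 3 → ℕ) : F r = 0 := by
  have h3 := h 3 (by decide)
  refine hF.eq_zero_of_confValue hn (fun j hj => h j (by omega)) (by omega) ?_ r
  rw [h1, h2, h3, show configs 2 2 0 = [((2, 1, 0), (2, 1, 0), 0, 0, 0), ((2, 2, 0), (1, 1, 0), 0,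
      0, 0)]
    by decide +kernel]
  simp only [List.mem_cons, List.not_mem_nil, or_false, forall_eq_or_imp, forall_eq]
  -- This reads $F(220|110)+2F(210|210)=0$.
  have e0 := hF.confValue_raise hn (i := 1) (j := 2) (by decide) (by decide) 2 1 0 1 1 0 0 0 0
  simp only [if_true, if_false, add_zero, zero_add, OfNat.ofNat_ne_one, OfNat.one_ne_ofNat,
    zero_ne_one, OfNat.zero_ne_ofNat] at e0
  simp only [hF.confValue_swap₁, hF.confValue_swap₂, hF.confValue_swap₃ hn,
    hF.confValue_swap₄ hn, hF.confValue_swap₅ hn, hF.confValue_swap₆ hn,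
    hF.confValue_block₁ hn, hF.confValue_block₂ hn] at e0 h0 ⊢
  clear h
  grind

theorem IsHighestWeight.eq_zero_four_one_of (hF : IsHighestWeight n l F) (hn : 3 ≤ n)
    (h1 : l 1 = 4) (h2 : l 2 = 1) (h : ∀ j, 3 ≤ j → l j = 0)
    (h0 : confValue F 2 1 0 1 1 1 0 0 0 = 0)
    (r : Fin n → Fin 3 → ℕ) : F r = 0 := by
  have h3 := h 3 (by decide)
  refine hF.eq_zero_of_confValue hn (fun j hj => h j (by omega)) (by omega) ?_ r
  rw [h1, h2, h3, show configs 4 1 0 = [((2, 1, 0), (1, 1, 1), 0, 0, 0), ((2, 1, 1), (1, 1, 0), 0,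
      0, 0)]
    by decide +kernel]
  simp only [List.mem_cons, List.not_mem_nil, or_false, forall_eq_or_imp, forall_eq]
  have e0 := hF.confValue_raise hn (i := 1) (j := 2) (by decide) (by decide) 1 1 0 1 1 1 0 0 0
  simp only [if_true, if_false, add_zero, zero_add, OfNat.ofNat_ne_one, OfNat.one_ne_ofNat,
    zero_ne_one, OfNat.zero_ne_ofNat] at e0
  simp only [hF.confValue_swap₁, hF.confValue_swap₂, hF.confValue_swap₃ hn,
    hF.confValue_swap₄ hn, hF.confValue_swap₅ hn, hF.confValue_swap₆ hn,
    hF.confValue_block₁ hn, hF.confValue_block₂ hn] at e0 h0 ⊢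
  clear h
  grind

theorem IsHighestWeight.eq_zero_three_two_of (hF : IsHighestWeight n l F) (hn : 3 ≤ n)
    (h1 : l 1 = 3) (h2 : l 2 = 2) (h : ∀ j, 3 ≤ j → l j = 0)
    (h0 : confValue F 2 1 1 2 1 0 0 0 0 = 0)
    (r : Fin n → Fin 3 → ℕ) : F r = 0 := by
  have h3 := h 3 (by decide)
  refine hF.eq_zero_of_confValue hn (fun j hj => h j (by omega)) (by omega) ?_ r
  rw [h1, h2, h3, show configs 3 2 0 = [((2, 1, 1), (2, 1, 0), 0, 0, 0), ((2, 2, 0), (1, 1, 1), 0,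
      0, 0), ((2, 2, 1), (1, 1, 0), 0, 0, 0)]
    by decide +kernel]
  simp only [List.mem_cons, List.not_mem_nil, or_false, forall_eq_or_imp, forall_eq]
  -- These read $2F(211|210)+2F(221|110)=0$ and $F(220|111)+3F(211|210)=0$.
  have e0 := hF.confValue_raise hn (i := 1) (j := 2) (by decide) (by decide) 1 1 0 2 1 1 0 0 0
  have e1 := hF.confValue_raise hn (i := 1) (j := 2) (by decide) (by decide) 2 1 0 1 1 1 0 0 0
  simp only [if_true, if_false, add_zero, zero_add, OfNat.ofNat_ne_one, OfNat.one_ne_ofNat,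
    zero_ne_one, OfNat.zero_ne_ofNat] at e0 e1
  simp only [hF.confValue_swap₁, hF.confValue_swap₂, hF.confValue_swap₃ hn,
    hF.confValue_swap₄ hn, hF.confValue_swap₅ hn, hF.confValue_swap₆ hn,
    hF.confValue_block₁ hn, hF.confValue_block₂ hn] at e0 e1 h0 ⊢
  clear h
  grind

end

end BV

namespace BV

noncomputable section

variable {n : ℕ} {μ : YoungDiagram}

/-! ### A statistic invariant under the block stabilizer -/

/-- The sum of the products of the labels of pairs of points in the same block. -/
def blockStat (r : Fin (3 * n) → ℕ) : ℕ :=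
  ∑ x : Fin (3 * n), ∑ y : Fin (3 * n), if (x : ℕ) / 3 = (y : ℕ) / 3 then r x * r y else 0

theorem blockStat_comp {c : Equiv.Perm (Fin (3 * n))} (hc : c ∈ blockStabilizer 3 n)
    (r : Fin (3 * n) → ℕ) : blockStat (r ∘ c) = blockStat r := by
  unfold blockStat
  refine Finset.sum_equiv c (by simp) fun x _ => Finset.sum_equiv c (by simp) fun y _ => ?_
  simp only [hc x y, Function.comp_apply]

/-- Extension of a labelling of the points by zero. -/
def extendZero {N : ℕ} (r : Fin N → ℕ) (x : ℕ) : ℕ := if h : x < N then r ⟨x, h⟩ else 0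

theorem extendZero_val {N : ℕ} (r : Fin N → ℕ) (x : Fin N) : extendZero r x = r x := by
  simp [extendZero]

/-- The statistic of a labelling with values `V` at the positions `K`. -/
def placedStat (K V : List (List ℕ)) : ℕ :=
  ((K.flatten.zip V.flatten).map fun p => ((K.flatten.zip V.flatten).map fun q =>
    if p.1 / 3 = q.1 / 3 then p.2 * q.2 else 0).sum).sum

theorem blockStat_eq_placedStat {K : List (List ℕ)} (hK : K.flatten.Nodup)
    (hlt : ∀ x ∈ K.flatten, x < 3 * n) {r : Fin (3 * n) → ℕ}
    (hr : ∀ x, x ∉ K.flatten → extendZero r x = 0) :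
    blockStat r = placedStat K (K.map fun col => col.map (extendZero r)) := by
  have hsub : K.flatten.toFinset ⊆ Finset.range (3 * n) := fun x hx =>
    Finset.mem_range.2 (hlt x (List.mem_toFinset.1 hx))
  have h1 : blockStat r = ∑ x ∈ Finset.range (3 * n), ∑ y ∈ Finset.range (3 * n),
      if x / 3 = y / 3 then extendZero r x * extendZero r y else 0 := by
    simp only [Finset.sum_range, extendZero_val]
    rfl
  have h2 : ∀ x, ∑ y ∈ Finset.range (3 * n),
      (if x / 3 = y / 3 then extendZero r x * extendZero r y else 0) =
      (K.flatten.map fun y => if x / 3 = y / 3 then extendZero r x * extendZero r y else 0).sum := by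
    intro x
    rw [← List.sum_toFinset _ hK]
    refine (Finset.sum_subset hsub fun y _ hy => ?_).symm
    rw [hr y (fun h => hy (List.mem_toFinset.2 h))]
    simp
  simp only [h1, h2]
  have h3 : ∑ x ∈ Finset.range (3 * n), (K.flatten.map fun y =>
      if x / 3 = y / 3 then extendZero r x * extendZero r y else 0).sum =
      (K.flatten.map fun x => (K.flatten.map fun y =>
        if x / 3 = y / 3 then extendZero r x * extendZero r y else 0).sum).sum := by
    rw [← List.sum_toFinset _ hK]
    refine (Finset.sum_subset hsub fun x _ hx => ?_).symm
    rw [hr x (fun h => hx (List.mem_toFinset.2 h))]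
    simp only [zero_mul, ite_self, List.map_const', List.sum_replicate, smul_zero]
  have h4 : K.flatten.zip (K.map fun col => col.map (extendZero r)).flatten =
      K.flatten.map fun x => (x, extendZero r x) := by
    rw [← List.map_flatten]
    generalize K.flatten = L
    induction L with
    | nil => rfl
    | cons x L ih => simp [ih]
  rw [h3, placedStat, h4, List.map_map]
  simp only [List.map_map, Function.comp_def]

/-! ### Tableaux with prescribed first columns -/

/-- The columns `K` of positions fit the first columns of `μ`, and the other columns of `μ`
have length at most one. -/
structure IsPlacement (μ : YoungDiagram) (n : ℕ) (K : List (List ℕ)) : Prop where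
  nodup : K.flatten.Nodup
  lt : ∀ x ∈ K.flatten, x < 3 * n
  inj : ∀ c < K.length, ∀ i < (K.getD c []).length, ∀ c' < K.length,
    ∀ i' < (K.getD c' []).length,
      (K.getD c []).getD i 0 = (K.getD c' []).getD i' 0 → c = c' ∧ i = i'
  mem : ∀ c < K.length, ∀ i, (i, c) ∈ μ ↔ i < (K.getD c []).length
  row : ∀ c, K.length ≤ c → ∀ i, (i, c) ∈ μ → i = 0

/-- The first columns of the tableau are `K`. -/
def Tableau.IsPlaced {N : ℕ} (t : Tableau μ N) (K : List (List ℕ)) : Prop :=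
  ∀ c : {c // c ∈ μ.cells}, c.1.2 < K.length → (t c : ℕ) = (K.getD c.1.2 []).getD c.1.1 0

theorem getD_mem_flatten {K : List (List ℕ)} {c i : ℕ} (hc : c < K.length)
    (hi : i < (K.getD c []).length) : (K.getD c []).getD i 0 ∈ K.flatten := by
  rw [List.getD_eq_getElem _ _ hi]
  refine List.mem_flatten.2 ⟨_, ?_, List.getElem_mem hi⟩
  rw [List.getD_eq_getElem _ _ hc]
  exact List.getElem_mem hc

theorem IsPlacement.exists_tableau {K : List (List ℕ)} (hK : IsPlacement μ n K) (hn : 0 < n)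
    (hμ : μ.card = 3 * n) : ∃ t : Tableau μ (3 * n), t.IsPlaced K := by
  classical
  have hcell : ∀ c : {c // c ∈ μ.cells}, c.1.2 < K.length →
      c.1.1 < (K.getD c.1.2 []).length := fun c hc =>
    (hK.mem _ hc _).1 ((YoungDiagram.mem_cells _).1 c.2)
  let f : {c // c ∈ μ.cells} → Fin (3 * n) := fun c =>
    if h : c.1.2 < K.length then
      ⟨(K.getD c.1.2 []).getD c.1.1 0, hK.lt _ (getD_mem_flatten h (hcell c h))⟩
    -- An arbitrary value: the extension to a bijection keeps `f` only on the columns in `K`.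
    else ⟨0, by omega⟩
  have hf : ∀ c, c.1.2 < K.length → (f c : ℕ) = (K.getD c.1.2 []).getD c.1.1 0 := by
    intro c hc
    simp only [f, dif_pos hc]
  obtain ⟨g, hg⟩ := Finset.exists_equiv_extend_of_card_eq
    (α := {c // c ∈ μ.cells}) (t := (Finset.univ : Finset (Fin (3 * n))))
    (by rw [Fintype.card_coe, Finset.card_univ, Fintype.card_fin]; exact hμ)
    (s := Finset.univ.filter fun c => c.1.2 < K.length) (f := f) (Finset.subset_univ _)
    (by
      intro c hc d hd hcd
      simp only [Finset.coe_filter, Finset.mem_univ, true_and, Set.mem_ofPred_eq] at hc hd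
      have := congrArg Fin.val hcd
      rw [hf c hc, hf d hd] at this
      obtain ⟨h1, h2⟩ := hK.inj _ hc _ (hcell c hc) _ hd _ (hcell d hd) this
      exact Subtype.ext (Prod.ext h2 h1))
  refine ⟨g.trans (Equiv.subtypeUnivEquiv (Finset.mem_univ ·)), fun c hc => ?_⟩
  rw [← hf c hc, ← hg c (by simpa using hc)]
  rfl

section Placed

variable {K : List (List ℕ)} {t : Tableau μ (3 * n)}

theorem Tableau.IsPlaced.exists_point (ht : t.IsPlaced K) (hK : IsPlacement μ n K) {c i : ℕ}
    (hc : c < K.length) (hi : i < (K.getD c []).length) :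
    ∃ x : Fin (3 * n), (x : ℕ) = (K.getD c []).getD i 0 ∧ t.tabloid.1 x = i ∧ t.col x = c := by
  have hmem : (i, c) ∈ μ.cells := (YoungDiagram.mem_cells _).2 ((hK.mem c hc i).2 hi)
  exact ⟨t ⟨(i, c), hmem⟩, ht ⟨(i, c), hmem⟩ hc, by simp [Tableau.tabloid], by simp [Tableau.col]⟩

theorem Tableau.mem_cell (t : Tableau μ (3 * n)) (x : Fin (3 * n)) :
    (t.tabloid.1 x, t.col x) ∈ μ := (YoungDiagram.mem_cells _).1 (t.symm x).2

/-- A letter outside `K` is in a column of length at most one, so a column permutation leaves it in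
row `0`. Hence `blockStat` sees only the columns `K`. -/
theorem Tableau.IsPlaced.extendZero_eq_zero (ht : t.IsPlaced K) (hK : IsPlacement μ n K)
    {π : Equiv.Perm (Fin (3 * n))} (hπ : π ∈ t.colStab) {x : ℕ} (hx : x ∉ K.flatten) :
    extendZero (π • t.tabloid).1 x = 0 := by
  unfold extendZero
  split_ifs with h
  · set y : Fin (3 * n) := ⟨x, h⟩ with hy
    have hcol : K.length ≤ t.col y := by
      by_contra hlt
      push Not at hlt
      have h1 := ht (t.symm y) hlt
      rw [Equiv.apply_symm_apply] at h1
      refine hx ?_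
      change x = _ at h1
      rw [h1]
      exact getD_mem_flatten hlt ((hK.mem _ hlt _).1 (t.mem_cell y))
    rw [smul_tabloid_apply]
    refine hK.row (t.col y) hcol _ ?_
    rw [← mem_colStab.1 (inv_mem_colStab hπ) y]
    exact t.mem_cell _
  · rfl

/-- The labels of the points in the first columns after a permutation. -/
def Tableau.placedValues (t : Tableau μ (3 * n)) (K : List (List ℕ))
    (π : Equiv.Perm (Fin (3 * n))) : List (List ℕ) :=
  K.map fun col => col.map (extendZero (π • t.tabloid).1)

/-- The column-wise rearrangements of the row indices on the columns `K`. -/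
def arrangements (K : List (List ℕ)) : List (List (List ℕ)) :=
  (K.map fun col => (List.range col.length).permutations').sections

/-- Within a column the new row indices are distinct and smaller than the column length, so they
rearrange the range. -/
theorem Tableau.IsPlaced.placedValues_mem (ht : t.IsPlaced K) (hK : IsPlacement μ n K)
    {π : Equiv.Perm (Fin (3 * n))} (hπ : π ∈ t.colStab) :
    t.placedValues K π ∈ arrangements K := by
  rw [arrangements, List.mem_sections, placedValues, List.forall₂_map_left_iff,
    List.forall₂_map_right_iff, List.forall₂_same]
  intro col hcol
  rw [List.mem_permutations']
  obtain ⟨c, hc, hcc⟩ := List.mem_iff_getElem.1 hcol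
  have hcc' : K.getD c [] = col := by rw [List.getD_eq_getElem _ _ hc, hcc]
  have hpt : ∀ x ∈ col, ∃ y : Fin (3 * n), (y : ℕ) = x ∧ t.col y = c := by
    intro x hx
    obtain ⟨i, hi, rfl⟩ := List.mem_iff_getElem.1 hx
    obtain ⟨y, h1, -, h3⟩ := ht.exists_point hK hc (i := i) (by rwa [hcc'])
    refine ⟨y, ?_, h3⟩
    rw [h1, hcc', List.getD_eq_getElem _ _ hi]
  have hcinv : ∀ y, t.col (π⁻¹ y) = t.col y := mem_colStab.1 (inv_mem_colStab hπ)
  refine (List.subperm_of_subset ?_ ?_).perm_of_length_le (by simp)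
  · refine List.Nodup.map_on ?_ ((List.nodup_flatten.1 hK.nodup).1 col hcol)
    intro x hx x' hx' heq
    obtain ⟨y, rfl, hy⟩ := hpt x hx
    obtain ⟨y', rfl, hy'⟩ := hpt x' hx'
    rw [extendZero_val, extendZero_val, smul_tabloid_apply, smul_tabloid_apply] at heq
    have := t.ext_row_col heq (by rw [hcinv, hcinv, hy, hy'])
    rw [π⁻¹.injective this]
  · intro v hv
    obtain ⟨x, hx, rfl⟩ := List.mem_map.1 hv
    obtain ⟨y, rfl, hy⟩ := hpt x hx
    rw [extendZero_val, smul_tabloid_apply, List.mem_range, ← hcc', ← hK.mem c hc]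
    have := t.mem_cell (π⁻¹ y)
    rwa [hcinv, hy] at this

theorem Tableau.IsPlaced.placedValues_one (ht : t.IsPlaced K) (hK : IsPlacement μ n K) :
    t.placedValues K 1 = K.map fun col => List.range col.length := by
  refine List.map_congr_left fun col hcol => ?_
  obtain ⟨c, hc, hcc⟩ := List.mem_iff_getElem.1 hcol
  have hcc' : K.getD c [] = col := by rw [List.getD_eq_getElem _ _ hc, hcc]
  refine List.ext_getElem (by simp) fun i h1 h2 => ?_
  rw [List.length_map] at h1
  obtain ⟨y, h3, h4, -⟩ := ht.exists_point hK hc (i := i) (by rwa [hcc'])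
  rw [hcc', List.getD_eq_getElem _ _ h1] at h3
  rw [List.getElem_map, List.getElem_range, ← h3, extendZero_val, one_smul, h4]

theorem Tableau.IsPlaced.eq_of_placedValues_eq (ht : t.IsPlaced K) (hK : IsPlacement μ n K)
    {π τ : Equiv.Perm (Fin (3 * n))} (hπ : π ∈ t.colStab) (hτ : τ ∈ t.colStab)
    (h : t.placedValues K π = t.placedValues K τ) : π = τ := by
  refine eq_of_smul_tabloid_eq hπ hτ (Subtype.ext (funext fun x => ?_))
  rw [← extendZero_val (π • t.tabloid).1 x, ← extendZero_val (τ • t.tabloid).1 x]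
  by_cases hx : (x : ℕ) ∈ K.flatten
  · obtain ⟨col, hcol, hxc⟩ := List.mem_flatten.1 hx
    exact List.map_inj_left.1 (List.map_inj_left.1 h col hcol) x hxc
  · rw [ht.extendZero_eq_zero hK hπ hx, ht.extendZero_eq_zero hK hτ hx]

/-- If all rearrangements of the first columns with the same block statistic are even, then
the Specht module has a nonzero vector fixed by the block stabilizer. -/
theorem Tableau.IsPlaced.exists_invariant (ht : t.IsPlaced K) (hK : IsPlacement μ n K)
    (h : ∀ V ∈ arrangements K,
      placedStat K V = placedStat K (K.map fun col => List.range col.length) →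
      ∃ π ∈ t.colStab, Equiv.Perm.sign π = 1 ∧ t.placedValues K π = V) :
    ∃ v ∈ (spechtModule μ (3 * n)).toSubmodule, v ≠ 0 ∧
      ∀ c ∈ blockStabilizer 3 n, tabloidRep μ (3 * n) c v = v := by
  refine exists_invariant_specht t blockStat (fun c hc r => blockStat_comp hc r) ?_
  intro π hπ hstat
  have key : ∀ τ ∈ t.colStab,
      blockStat (τ • t.tabloid).1 = placedStat K (t.placedValues K τ) := fun τ hτ =>
    blockStat_eq_placedStat hK.nodup hK.lt fun x hx => ht.extendZero_eq_zero hK hτ hx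
  have h1 := key 1 t.one_mem_colStab
  rw [one_smul, ht.placedValues_one hK] at h1
  rw [key π hπ, h1] at hstat
  obtain ⟨τ, hτ, hs, hv⟩ := h _ (ht.placedValues_mem hK hπ) hstat
  rw [ht.eq_of_placedValues_eq hK hπ hτ hv.symm, hs]

end Placed

/-- Specht modules with a placement whose block statistic determines the arrangement have
a nonzero invariant vector. -/
theorem IsPlacement.exists_invariant {K : List (List ℕ)} (hK : IsPlacement μ n K) (hn : 0 < n)
    (hμ : μ.card = 3 * n)
    (h : ∀ V ∈ arrangements K,
      placedStat K V = placedStat K (K.map fun col => List.range col.length) →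
      V = K.map fun col => List.range col.length) :
    ∃ v ∈ (spechtModule μ (3 * n)).toSubmodule, v ≠ 0 ∧
      ∀ c ∈ blockStabilizer 3 n, tabloidRep μ (3 * n) c v = v := by
  obtain ⟨t, ht⟩ := hK.exists_tableau hn hμ
  refine ht.exists_invariant hK fun V hV hs => ⟨1, t.one_mem_colStab, map_one _, ?_⟩
  rw [ht.placedValues_one hK, h V hV hs]

end

end BV

namespace BV

noncomputable section

variable {n : ℕ} {μ : YoungDiagram} {l : List ℕ}

/-! ### Partitions with a given pattern -/

theorem rowLen_eq_getD (μ : YoungDiagram) (i : ℕ) : μ.rowLen i = μ.rowLens.getD i 0 := by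
  by_cases hi : i < μ.rowLens.length
  · rw [List.getD_eq_getElem _ _ hi, YoungDiagram.get_rowLens]
  · rw [List.getD_eq_default _ _ (not_lt.1 hi)]
    rw [YoungDiagram.length_rowLens] at hi
    by_contra h
    exact hi (YoungDiagram.mem_iff_lt_colLen.1
      (YoungDiagram.mem_iff_lt_rowLen.2 (Nat.pos_of_ne_zero h)))

theorem card_eq_sum_rowLens (μ : YoungDiagram) : μ.card = μ.rowLens.sum := by
  obtain ⟨t⟩ := exists_tableau (rfl : μ.card = μ.card)
  have h := Finset.card_eq_sum_card_fiberwise (s := (Finset.univ : Finset (Fin μ.card)))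
    (f := t.tabloid.1) (t := Finset.range (μ.colLen 0)) (fun x _ => by
      have h1 : (t.tabloid.1 x, t.col x) ∈ μ := (YoungDiagram.mem_cells _).1 (t.symm x).2
      have h2 : (t.tabloid.1 x, 0) ∈ μ := μ.up_left_mem le_rfl (Nat.zero_le _) h1
      simpa using YoungDiagram.mem_iff_lt_colLen.1 h2)
  rw [Finset.card_univ, Fintype.card_fin] at h
  rw [h, YoungDiagram.rowLens, Finset.sum_congr rfl fun i _ => t.tabloid.2 i]
  rfl

theorem HasPattern.rowLen_succ {N : ℕ} (h : HasPattern N l μ) (i : ℕ) :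
    μ.rowLen (i + 1) = l.getD i 0 := by
  obtain ⟨-, a, ha⟩ := h
  rw [rowLen_eq_getD, ha, List.getD_cons_succ]

theorem HasPattern.rowLen_zero {N : ℕ} (h : HasPattern N l μ) : N = μ.rowLen 0 + l.sum := by
  obtain ⟨hN, a, ha⟩ := h
  rw [← hN, card_eq_sum_rowLens, rowLen_eq_getD, ha, List.sum_cons, List.getD_cons_zero]

theorem HasPattern.add_le {N : ℕ} (h : HasPattern N l μ) : l.getD 0 0 + l.sum ≤ N := by
  rw [h.rowLen_zero, ← h.rowLen_succ 0]
  exact Nat.add_le_add_right (μ.rowLen_anti 0 1 zero_le_one) _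

/-- The second inequality, which makes the first part positive, adds something only for `l = []`. -/
theorem exists_hasPattern {N : ℕ} (hl : l.SortedGE) (hpos : ∀ x ∈ l, 0 < x)
    (h : l.getD 0 0 + l.sum ≤ N) (hN : l.sum < N) : ∃ μ, HasPattern N l μ := by
  have hs : ((N - l.sum) :: l).SortedGE := by
    rw [List.sortedGE_iff_pairwise, List.pairwise_cons]
    refine ⟨fun x hx => ?_, List.sortedGE_iff_pairwise.1 hl⟩
    have hx0 : x ≤ l.getD 0 0 := by
      cases l with
      | nil => simp at hx
      | cons y l =>
        rcases List.mem_cons.1 hx with rfl | hx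
        · simp
        · exact (List.pairwise_cons.1 (List.sortedGE_iff_pairwise.1 hl)).1 x hx
    change x ≤ N - l.sum
    omega
  have hp : ∀ x ∈ (N - l.sum) :: l, 0 < x := by
    intro x hx
    rcases List.mem_cons.1 hx with rfl | hx
    · omega
    · exact hpos x hx
  refine ⟨YoungDiagram.ofRowLens _ hs, ?_, N - l.sum,
    YoungDiagram.rowLens_ofRowLens_eq_self hp⟩
  rw [card_eq_sum_rowLens, YoungDiagram.rowLens_ofRowLens_eq_self hp, List.sum_cons]
  omega

/-- The columns `K` have the lengths prescribed by the lower rows `l`, and their entries are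
distinct positions below `15`. -/
abbrev FitsPattern (l : List ℕ) (K : List (List ℕ)) : Prop :=
  K.flatten.Nodup ∧ (∀ x ∈ K.flatten, x < 15) ∧
  (∀ c ∈ List.range K.length, ∀ i ∈ List.range (K.getD c []).length,
    ∀ c' ∈ List.range K.length, ∀ i' ∈ List.range (K.getD c' []).length,
      (K.getD c []).getD i 0 = (K.getD c' []).getD i' 0 → c = c' ∧ i = i') ∧
  K.length = l.getD 0 0 ∧
  (∀ c ∈ List.range K.length,
    0 < (K.getD c []).length ∧ (K.getD c []).length ≤ l.length + 1 ∧
    ∀ k ∈ List.range l.length, (c < l.getD k 0 ↔ k + 1 < (K.getD c []).length))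

theorem FitsPattern.isPlacement {K : List (List ℕ)} (hK : FitsPattern l K) (hn : 5 ≤ n)
    (h : HasPattern (3 * n) l μ) : IsPlacement μ n K := by
  obtain ⟨h1, h2, h3, h4, h5⟩ := hK
  simp only [List.mem_range] at h3 h5
  refine ⟨h1, fun x hx => (h2 x hx).trans_le (by omega), h3, fun c hc i => ?_, fun c hc i hi => ?_⟩
  · obtain ⟨h6, h7, h8⟩ := h5 c hc
    rw [YoungDiagram.mem_iff_lt_rowLen]
    cases i with
    | zero =>
      have := μ.rowLen_anti 0 1 zero_le_one
      rw [h.rowLen_succ 0, ← h4] at this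
      exact iff_of_true (hc.trans_le this) h6
    | succ k =>
      rw [h.rowLen_succ]
      by_cases hk : k < l.length
      · exact h8 k hk
      · rw [List.getD_eq_default _ _ (not_lt.1 hk)]
        omega
  · rw [YoungDiagram.mem_iff_lt_rowLen] at hi
    by_contra h0
    have := μ.rowLen_anti 1 i (Nat.one_le_iff_ne_zero.2 h0)
    rw [h.rowLen_succ 0, ← h4] at this
    omega

theorem HasPattern.mult_eq_one {K : List (List ℕ)} (h : HasPattern (3 * n) l μ) (hn : 5 ≤ n)
    (hK : FitsPattern l K)
    (hu : ∀ V ∈ arrangements K,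
      placedStat K V = placedStat K (K.map fun col => List.range col.length) →
      V = K.map fun col => List.range col.length) (r₀ : Fin n → Fin 3 → ℕ)
    (hF : ∀ F, IsHighestWeight n μ.rowLen F → F r₀ = 0 → ∀ r, F r = 0) : mult μ n = 1 := by
  obtain ⟨v, hv, hv0, hvC⟩ := (hK.isPlacement hn h).exists_invariant (by omega) h.1 hu
  exact BV.mult_eq_one h.1 hv hv0 hvC r₀ hF

theorem HasPattern.mult_eq_one_two_two (h : HasPattern (3 * n) [2, 2] μ) (hn : 5 ≤ n)
    (r₀ : Fin n → Fin 3 → ℕ)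
    (hF : ∀ F, IsHighestWeight n μ.rowLen F → F r₀ = 0 → ∀ r, F r = 0) : mult μ n = 1 := by
  have hfits : FitsPattern [2, 2] [[9, 0, 3], [12, 1, 4]] := by decide +kernel
  have hK := hfits.isPlacement hn h
  obtain ⟨t, ht⟩ := hK.exists_tableau (by omega) h.1
  -- The lower rows occupy the pairs `{0, 1}` and `{3, 4}`, each inside one block. Exchanging these
  -- rows in both columns keeps the statistic, so the arrangement is not unique; but this is a
  -- product of two transpositions, hence even.
  have key : ∀ V ∈ arrangements [[9, 0, 3], [12, 1, 4]],
      placedStat [[9, 0, 3], [12, 1, 4]] V = placedStat [[9, 0, 3], [12, 1, 4]]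
        ([[9, 0, 3], [12, 1, 4]].map fun col => List.range col.length) →
      V = [[0, 1, 2], [0, 1, 2]] ∨ V = [[0, 2, 1], [0, 2, 1]] := by decide +kernel
  obtain ⟨a₁, ha₁, ra₁, ca₁⟩ := ht.exists_point hK (c := 0) (i := 0) (by decide) (by decide)
  obtain ⟨b₁, hb₁, rb₁, cb₁⟩ := ht.exists_point hK (c := 0) (i := 1) (by decide) (by decide)
  obtain ⟨c₁, hc₁, rc₁, cc₁⟩ := ht.exists_point hK (c := 0) (i := 2) (by decide) (by decide)
  obtain ⟨a₂, ha₂, ra₂, ca₂⟩ := ht.exists_point hK (c := 1) (i := 0) (by decide) (by decide)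
  obtain ⟨b₂, hb₂, rb₂, cb₂⟩ := ht.exists_point hK (c := 1) (i := 1) (by decide) (by decide)
  obtain ⟨c₂, hc₂, rc₂, cc₂⟩ := ht.exists_point hK (c := 1) (i := 2) (by decide) (by decide)
  change (a₁ : ℕ) = 9 at ha₁
  change (b₁ : ℕ) = 0 at hb₁
  change (c₁ : ℕ) = 3 at hc₁
  change (a₂ : ℕ) = 12 at ha₂
  change (b₂ : ℕ) = 1 at hb₂
  change (c₂ : ℕ) = 4 at hc₂
  obtain ⟨v, hv, hv0, hvC⟩ := ht.exists_invariant hK fun V hV hs => by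
    rcases key V hV hs with rfl | rfl
    · exact ⟨1, t.one_mem_colStab, map_one _, ht.placedValues_one hK⟩
    · refine ⟨Equiv.swap b₁ c₁ * Equiv.swap b₂ c₂, Tableau.mul_mem_colStab
        (Tableau.swap_mem_colStab (cb₁.trans cc₁.symm))
        (Tableau.swap_mem_colStab (cb₂.trans cc₂.symm)), ?_, ?_⟩
      · have h1 : b₁ ≠ c₁ := fun h => by rw [h] at hb₁; omega
        have h2 : b₂ ≠ c₂ := fun h => by rw [h] at hb₂; omega
        rw [Equiv.Perm.sign_mul, Equiv.Perm.sign_swap h1, Equiv.Perm.sign_swap h2]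
        rfl
      · set σ := Equiv.swap b₁ c₁ * Equiv.swap b₂ c₂ with hσ
        have hval : ∀ (x y : Fin (3 * n)) (m : ℕ), (y : ℕ) = m → σ x = y →
            extendZero (σ • t.tabloid).1 m = t.tabloid.1 x := by
          rintro x y _ rfl rfl
          rw [extendZero_val, smul_tabloid_apply, ← Equiv.Perm.mul_apply, inv_mul_cancel,
            Equiv.Perm.one_apply]
        have hne : ∀ {x y : Fin (3 * n)} {i j : ℕ}, (x : ℕ) = i → (y : ℕ) = j → i ≠ j → x ≠ y := by
          rintro x y _ _ rfl rfl hij rfl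
          exact hij rfl
        have h1 : σ a₁ = a₁ := by
          rw [hσ, Equiv.Perm.mul_apply, Equiv.swap_apply_of_ne_of_ne (hne ha₁ hb₂ (by decide))
            (hne ha₁ hc₂ (by decide)), Equiv.swap_apply_of_ne_of_ne (hne ha₁ hb₁ (by decide))
            (hne ha₁ hc₁ (by decide))]
        have h2 : σ b₁ = c₁ := by
          rw [hσ, Equiv.Perm.mul_apply, Equiv.swap_apply_of_ne_of_ne (hne hb₁ hb₂ (by decide))
            (hne hb₁ hc₂ (by decide)), Equiv.swap_apply_left]
        have h3 : σ c₁ = b₁ := by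
          rw [hσ, Equiv.Perm.mul_apply, Equiv.swap_apply_of_ne_of_ne (hne hc₁ hb₂ (by decide))
            (hne hc₁ hc₂ (by decide)), Equiv.swap_apply_right]
        have h4 : σ a₂ = a₂ := by
          rw [hσ, Equiv.Perm.mul_apply, Equiv.swap_apply_of_ne_of_ne (hne ha₂ hb₂ (by decide))
            (hne ha₂ hc₂ (by decide)), Equiv.swap_apply_of_ne_of_ne (hne ha₂ hb₁ (by decide))
            (hne ha₂ hc₁ (by decide))]
        have h5 : σ b₂ = c₂ := by
          rw [hσ, Equiv.Perm.mul_apply, Equiv.swap_apply_left, Equiv.swap_apply_of_ne_of_ne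
            (hne hc₂ hb₁ (by decide)) (hne hc₂ hc₁ (by decide))]
        have h6 : σ c₂ = b₂ := by
          rw [hσ, Equiv.Perm.mul_apply, Equiv.swap_apply_right, Equiv.swap_apply_of_ne_of_ne
            (hne hb₂ hb₁ (by decide)) (hne hb₂ hc₁ (by decide))]
        simp only [Tableau.placedValues, List.map_cons, List.map_nil]
        rw [hval a₁ a₁ 9 ha₁ h1, hval c₁ b₁ 0 hb₁ h3, hval b₁ c₁ 3 hc₁ h2, hval a₂ a₂ 12 ha₂ h4,
          hval c₂ b₂ 1 hb₂ h6, hval b₂ c₂ 4 hc₂ h5, ra₁, rb₁, rc₁, ra₂, rb₂, rc₂]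
  exact BV.mult_eq_one h.1 hv hv0 hvC r₀ hF

end

end BV

/-! ### Assembly of the two halves. -/

namespace BV

theorem HasPattern.rowLen_eq_zero {N : ℕ} {l : List ℕ} {μ : YoungDiagram} (h : HasPattern N l μ)
    (j : ℕ) (hj : l.length + 1 ≤ j) : μ.rowLen j = 0 := by
  obtain ⟨i, rfl⟩ : ∃ i, j = i + 1 := ⟨j - 1, by omega⟩
  rw [h.rowLen_succ, List.getD_eq_default _ _ (by omega)]

theorem mult_eq_one_of_mem {n : ℕ} (hn : 5 ≤ n) {l : List ℕ} {μ : YoungDiagram}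
    (hl : l ∈ ([[], [2], [3], [4], [2, 2], [5], [4, 1], [3, 2]] : List (List ℕ)))
    (h : HasPattern (3 * n) l μ) : mult μ n = 1 := by
  have hn' : 3 ≤ n := by omega
  have h1 := h.rowLen_succ 0
  have h2 := h.rowLen_succ 1
  have hz := h.rowLen_eq_zero
  simp only [List.mem_cons, List.not_mem_nil, or_false] at hl
  rcases hl with rfl | rfl | rfl | rfl | rfl | rfl | rfl | rfl
  · exact h.mult_eq_one (K := []) hn (by decide +kernel) (by decide +kernel) _
      fun F hF h0 => hF.eq_zero_nil_of hn' h1 (fun j hj => hz j (Nat.le_of_succ_le hj)) h0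
  -- In these placements the letters of the lower rows are gathered in common blocks and those of
  -- row `0` are kept out of these blocks. Here `0` and `1` share a block while `7` and `12` lie in
  -- two others, so any other arrangement separates the two labels `1` and lowers the statistic.
  · exact h.mult_eq_one (K := [[12, 1], [7, 0]]) hn (by decide +kernel) (by decide +kernel) _
      fun F hF h0 => hF.eq_zero_two_of hn' h1 hz h0
  · exact h.mult_eq_one (K := [[2, 3], [1, 4], [8, 5]]) hn (by decide +kernel)
      (by decide +kernel) _ fun F hF h0 => hF.eq_zero_three_of hn' h1 hz h0
  · exact h.mult_eq_one (K := [[4, 9], [6, 14], [2, 13], [7, 11]]) hn (by decide +kernel)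
      (by decide +kernel) _ fun F hF h0 => hF.eq_zero_four_of hn' h1 hz h0
  · exact h.mult_eq_one_two_two hn _ fun F hF h0 => hF.eq_zero_two_two_of hn' h1 h2 hz h0
  · exact h.mult_eq_one (K := [[10, 14], [11, 12], [5, 0], [7, 1], [4, 13]]) hn
      (by decide +kernel) (by decide +kernel) _
      fun F hF h0 => hF.eq_zero_five_of hn' h1 hz h0
  · exact h.mult_eq_one (K := [[8, 2, 13], [11, 12], [3, 1], [5, 14]]) hn (by decide +kernel)
      (by decide +kernel) _ fun F hF h0 => hF.eq_zero_four_one_of hn' h1 h2 hz h0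
  · exact h.mult_eq_one (K := [[1, 6, 12], [11, 8, 13], [0, 14]]) hn (by decide +kernel)
      (by decide +kernel) _ fun F hF h0 => hF.eq_zero_three_two_of hn' h1 h2 hz h0

theorem mult_eq_zero_of_mem {n : ℕ} {l : List ℕ} {μ : YoungDiagram}
    (hl : l ∈ ([[1], [2, 1], [3, 1], [2, 2, 1], [3, 1, 1], [4, 1, 1]] : List (List ℕ)))
    (h : HasPattern (3 * n) l μ) : mult μ n = 0 := by
  have h1 := h.rowLen_succ 0
  have h2 := h.rowLen_succ 1
  have h3 := h.rowLen_succ 2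
  have hz := h.rowLen_eq_zero
  have hle := h.add_le
  refine mult_eq_zero h.1 fun F hF => ?_
  simp only [List.mem_cons, List.not_mem_nil, or_false] at hl
  -- A partition with the pattern requires $\lambda_1+|\lambda|\le 3n$, which forces $n\ge 3$ for
  -- the last four patterns.
  rcases hl with rfl | rfl | rfl | rfl | rfl | rfl <;> simp at hle
  · exact hF.eq_zero_one h1 hz
  · exact hF.eq_zero_two_one h1 h2 hz
  · exact hF.eq_zero_three_one (by omega) h1 h2 hz
  · exact hF.eq_zero_two_two_one (by omega) h1 h2 h3 hz
  · exact hF.eq_zero_three_one_one (by omega) h1 h2 h3 hz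
  · exact hF.eq_zero_four_one_one (by omega) h1 h2 h3 hz

end BV

theorem mainTheorem4 :
    (∀ n : ℕ, 5 ≤ n →
      ∀ l ∈ ([[], [2], [3], [4], [2, 2], [5], [4, 1], [3, 2]] : List (List ℕ)),
        (∃ μ : YoungDiagram, BV.HasPattern (3 * n) l μ) ∧
        ∀ μ : YoungDiagram, BV.HasPattern (3 * n) l μ → BV.mult μ n = 1) ∧
    (∀ n : ℕ,
      ∀ l ∈ ([[1], [2, 1], [3, 1], [2, 2, 1], [3, 1, 1], [4, 1, 1]] : List (List ℕ)),
        ∀ μ : YoungDiagram, BV.HasPattern (3 * n) l μ → BV.mult μ n = 0) := by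
  refine ⟨fun n hn l hl => ⟨?_, fun μ => BV.mult_eq_one_of_mem hn hl⟩,
    fun n l hl μ => BV.mult_eq_zero_of_mem hl⟩
  simp only [List.mem_cons, List.not_mem_nil, or_false] at hl
  rcases hl with rfl | rfl | rfl | rfl | rfl | rfl | rfl | rfl <;>
    refine BV.exists_hasPattern (List.sortedGE_iff_pairwise.2 (by decide)) (by decide) ?_ ?_ <;>
    simp <;> omega
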